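/- Let $\mathcal A',\mathcal A,\mathcal A''$ be abelian categories, where $\mathcal A''$ has all small colimits and satisfies AB5 (filtered colimits are exact), and let $$T:\mathcal A'\times\mathcal A\to\mathcal A'',\qquad H:\mathcal A^{op}\times\mathcal A''\to\mathcal A',\qquad C:\mathcal A'^{op}\times\mathcal A''\to\mathcal A$$ be a biadditive adjunction of two variables, i.e. functors, additive in each variable, with natural isomorphisms $\mathcal A''(T(X',X),X'')\cong\mathcal A'(X',H(X,X''))\cong\mathcal A(X,C(X',X''))$. An object $P'$ of $\mathcal A'$ is flat if $T(P',-)$ preserves monomorphisms, and an object $P$ of $\mathcal A$ is flat if $T(-,P)$ preserves monomorphisms; let $\mathcal F'$, $\mathcal F$ be the classes of flat objects. For a class $\mathcal K$ of objects of an abelian category, $\mathcal K^\perp$ (resp. ${}^\perp\mathcal K$) is the class of objects $X$ such that every morphism to $X$ extends along every monomorphism with cokernel in $\mathcal K$ (resp. every morphism from $X$ lifts along every epimorphism with kernel in $\mathcal K$). Suppose that $(\mathcal F',\mathcal F'^\perp)$ and $(\mathcal F,\mathcal F^\perp)$ are left complete cotorsion theories; here $(\mathcal X,\mathcal Y)$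 is a cotorsion theory if $\mathcal X={}^\perp\mathcal Y$ and $\mathcal Y=\mathcal X^\perp$, and it is left complete if every object $M$ sits in a short exact sequence $0\to Y\to X\to M\to 0$ with $Y\in\mathcal Y$, $X\in\mathcal X$. A complete flat resolution of an object $M$ is a quasi-isomorphism $\mathbf R\to S^0(M)$ (with $S^0(M)$ the complex $M$ in degree $0$), where $\mathbf R$ is a degreewise flat chain complex with $\mathbf R_n=0$ for $n<0$ whose boundaries $B_n(\mathbf R)$ all lie in $\mathcal F'^\perp$ (resp. $\mathcal F^\perp$). For chain complexes $\mathbf C'$, $\mathbf C$ indexed by $\mathbb Z$ in $\mathcal A'$, $\mathcal A$, the complex $T(\mathbf C',\mathbf C)$ has $T(\mathbf C',\mathbf C)_n=\bigoplus_{p+q=n}T(\mathbf C'_p,\mathbf C_q)$ with differential $T(d'_p,1)+(-1)^pT(1,d_q)$ on the summand $(p,q)$. Set $\mathsf{Tor}_n(A',A)=H_n(T(\mathbf R',\mathbf R))$, where $\mathbf R'$, $\mathbf R$ are complete flat resolutions of $A'$, $A$. Homology is regarded as a complex with zero differential. The inclusions of cycles induce $z:T(Z(\mathbf C'),Z(\mathbf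 C))\to Z(T(\mathbf C',\mathbf C))$, and $\gamma:T(H(\mathbf C'),H(\mathbf C))\to H(T(\mathbf C',\mathbf C))$ is the unique morphism whose composite with the epimorphism $T(Z(\mathbf C'),Z(\mathbf C))\to T(H(\mathbf C'),H(\mathbf C))$ is $z$ followed by the projection $Z(T(\mathbf C',\mathbf C))\to H(T(\mathbf C',\mathbf C))$. Then every object of $\mathcal A'$ and of $\mathcal A$ has a complete flat resolution. Moreover, let $\mathbf C'$, $\mathbf C$ be chain complexes indexed by $\mathbb Z$ in $\mathcal A'$, $\mathcal A$ such that the boundaries $B_n(\mathbf C)$ and the cycles $Z_n(\mathbf C)$ are flat for all $n$. Then, for every choice of the complete flat resolutions of the objects $H_p(\mathbf C')$ and $H_q(\mathbf C)$ ($p,q\in\mathbb Z$) used to define $\mathsf{Tor}_1$, there is a short exact sequence of complexes (with zero differential) in $\mathcal A''$ $$0\to T(H(\mathbf C'),H(\mathbf C))\xrightarrow{\ \gamma\ }H(T(\mathbf C',\mathbf C))\to\mathsf{Tor}_1(H(\mathbf C'),H(\mathbf C))\to 0,$$ where $\mathsf{Tor}_1(H(\mathbf C'),H(\mathbf C))_n=\bigoplus_{p+q=n}\mathsf{Tor}_1(H_p(\mathbf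 C'),H_{q-1}(\mathbf C))$. -/

import Mathlib

open CategoryTheory Limits

universe v₁ v₂ v₃ v u₁ u₂ u₃ u

noncomputable section

namespace THCKunneth

/-! ### Cotorsion theories -/

section Cotorsion

variable {A : Type u} [Category.{v} A] [Abelian A]

/-- `K^⊥`: the objects `X` such that every morphism to `X` extends along every monomorphism
whose cokernel is in `K`. -/
def rightPerp (K : ObjectProperty A) : ObjectProperty A := fun X =>
  ∀ ⦃Y Z : A⦄ (i : Y ⟶ Z) [Mono i], K (cokernel i) → ∀ f : Y ⟶ X, ∃ g : Z ⟶ X, i ≫ g = f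

/-- `^⊥K`: the objects `X` such that every morphism from `X` lifts along every epimorphism
whose kernel is in `K`. -/
def leftPerp (K : ObjectProperty A) : ObjectProperty A := fun X =>
  ∀ ⦃Y Z : A⦄ (p : Y ⟶ Z) [Epi p], K (kernel p) → ∀ f : X ⟶ Z, ∃ g : X ⟶ Y, g ≫ p = f

/-- `(X, Y)` is a cotorsion theory: `X = ^⊥Y` and `Y = X^⊥`. -/
structure IsCotorsionTheory (X Y : ObjectProperty A) : Prop where
  left_eq : X = leftPerp Y
  right_eq : Y = rightPerp X

/-- `(X, Y)` is a left complete cotorsion theory: moreover, every object `M` sits in a short exact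
sequence `0 ⟶ V ⟶ U ⟶ M ⟶ 0` with `V` in `Y` and `U` in `X`. -/
structure IsLeftCompleteCotorsionTheory (X Y : ObjectProperty A) : Prop
    extends IsCotorsionTheory X Y where
  exists_shortExact (M : A) : ∃ (V U : A) (i : V ⟶ U) (p : U ⟶ M) (w : i ≫ p = 0),
    Y V ∧ X U ∧ (ShortComplex.mk i p w).ShortExact

/-- The degree `n` boundaries of a chain complex: the image of `d : C_{n+1} ⟶ C_n`. -/
abbrev boundaries (C : ChainComplex A ℤ) (n : ℤ) : A := Limits.image (C.d (n + 1) n)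

/-- A complete `K`-resolution of `M`: a quasi-isomorphism `π` from a complex which is degreewise
in `K` and zero in negative degrees to `M` in degree `0`, such that all the boundaries
are in `K^⊥`. -/
structure CompleteResolution (K : ObjectProperty A) (M : A) where
  complex : ChainComplex A ℤ
  mem (n : ℤ) : K (complex.X n)
  isZero (n : ℤ) (hn : n < 0) : IsZero (complex.X n)
  π : complex ⟶ (HomologicalComplex.single A (ComplexShape.down ℤ) 0).obj M
  quasiIso : QuasiIso π
  boundaries_mem (n : ℤ) : rightPerp K (boundaries complex n)

/-- A family of objects as a complex with zero differential. -/
@[simps]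
def zeroComplex (X : ℤ → A) : ChainComplex A ℤ where
  X := X
  d _ _ := 0

/-- The homology of a chain complex, as a complex with zero differential. -/
abbrev homologyComplex (C : ChainComplex A ℤ) : ChainComplex A ℤ :=
  zeroComplex (fun n => C.homology n)

/-- If `F` is a left adjoint, `F(H_n(C))` is the cokernel of `F(C_{n+1}) ⟶ F(Z_n(C))`. -/
def descHomology {B : Type u₁} [Category.{v₁} B] [Preadditive B] (F : A ⥤ B) [F.Additive]
    [F.IsLeftAdjoint] (C : ChainComplex A ℤ) (n : ℤ) {Y : B} (g : F.obj (C.cycles n) ⟶ Y)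
    (hg : F.map (C.toCycles (n + 1) n) ≫ g = 0) : F.obj (C.homology n) ⟶ Y :=
  haveI : PreservesColimits F := (Adjunction.ofIsLeftAdjoint F).leftAdjoint_preservesColimits
  (CokernelCofork.mapIsColimit _ (C.homologyIsCokernel (n + 1) n (by simp)) F).desc
    (CokernelCofork.ofπ g hg)

lemma π_descHomology {B : Type u₁} [Category.{v₁} B] [Preadditive B] (F : A ⥤ B) [F.Additive]
    [F.IsLeftAdjoint] (C : ChainComplex A ℤ) (n : ℤ) {Y : B} (g : F.obj (C.cycles n) ⟶ Y)
    (hg : F.map (C.toCycles (n + 1) n) ≫ g = 0) :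
    F.map (C.homologyπ n) ≫ descHomology F C n g hg = g :=
  haveI : PreservesColimits F := (Adjunction.ofIsLeftAdjoint F).leftAdjoint_preservesColimits
  (CokernelCofork.mapIsColimit _ (C.homologyIsCokernel (n + 1) n (by simp)) F).fac
    (CokernelCofork.ofπ g hg) WalkingParallelPair.one

end Cotorsion

/-! ### Biadditive tensor-hom-cotensor situations -/

/-- A biadditive tensor-hom-cotensor situation (an adjunction of two variables, with `T`
additive in each variable). -/
structure BiadditiveTHC (A₁ : Type u₁) (A₂ : Type u₂) (A₃ : Type u₃)
    [Category.{v₁} A₁] [Category.{v₂} A₂] [Category.{v₃} A₃]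
    [Preadditive A₁] [Preadditive A₂] [Preadditive A₃] where
  T : A₁ ⥤ A₂ ⥤ A₃
  hom : A₂ᵒᵖ ⥤ A₃ ⥤ A₁
  cot : A₁ᵒᵖ ⥤ A₃ ⥤ A₂
  adjHom : T.flip ⊣₂ hom
  adjCot : T ⊣₂ cot
  additive_left : T.Additive
  additive_right (X₁ : A₁) : (T.obj X₁).Additive

attribute [instance] BiadditiveTHC.additive_left BiadditiveTHC.additive_right

/-- In the total complex of a tensor product of chain complexes indexed by `ℤ`, the differential
of the second factor carries the sign `(-1)^p` on the summand of bidegree `(p, q)`. -/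
instance tensorSignsDownInt : (ComplexShape.down ℤ).TensorSigns where
  ε' := MonoidHom.mk' (fun i : Multiplicative ℤ => Int.negOnePow i.toAdd)
    (fun a b => Int.negOnePow_add a.toAdd b.toAdd)
  rel_add p q r hpq := by
    have h : q + 1 = p := hpq
    change q + r + 1 = p + r
    lia
  add_rel p q r hpq := by
    have h : q + 1 = p := hpq
    change r + q + 1 = r + p
    lia
  ε'_succ p q hpq := by
    have h : q + 1 = p := hpq
    subst h
    change Int.negOnePow q = - Int.negOnePow (q + 1)
    rw [Int.negOnePow_succ, neg_neg]

namespace BiadditiveTHC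

variable {A₁ : Type u₁} {A₂ : Type u₂} {A₃ : Type u₃}
  [Category.{v₁} A₁] [Category.{v₂} A₂] [Category.{v₃} A₃]
  [Abelian A₁] [Abelian A₂] [Abelian A₃]
  (S : BiadditiveTHC A₁ A₂ A₃)

/-- The flat objects of the first category: `T(P, -)` preserves monomorphisms. -/
def flat₁ : ObjectProperty A₁ := fun P =>
  ∀ ⦃X Y : A₂⦄ (f : X ⟶ Y) [Mono f], Mono ((S.T.obj P).map f)

/-- The flat objects of the second category: `T(-, P)` preserves monomorphisms. -/
def flat₂ : ObjectProperty A₂ := fun P =>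
  ∀ ⦃X Y : A₁⦄ (f : X ⟶ Y) [Mono f], Mono ((S.T.map f).app P)

variable [HasColimits A₃] (C₁ : ChainComplex A₁ ℤ) (C₂ : ChainComplex A₂ ℤ)

/-- `T(C₁, C₂)`: in degree `n` it is the coproduct of the `T((C₁)_p, (C₂)_q)` with `p + q = n`;
the differential is `T(d, 1) + (-1)^p T(1, d)` on the summand of bidegree `(p, q)`. -/
abbrev tensor : ChainComplex A₃ ℤ :=
  HomologicalComplex.mapBifunctor C₁ C₂ S.T (ComplexShape.down ℤ)

/-- The inclusion of the summand of bidegree `(p, q)`. -/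
abbrev ι (p q n : ℤ) (h : p + q = n) :
    (S.T.obj (C₁.X p)).obj (C₂.X q) ⟶ (S.tensor C₁ C₂).X n :=
  HomologicalComplex.ιMapBifunctor C₁ C₂ S.T (ComplexShape.down ℤ) p q n h

lemma ι_d (p q n p' q' n' : ℤ) (h : p + q = n) (hp : p' + 1 = p) (hq : q' + 1 = q)
    (hn : n' + 1 = n) :
    S.ι C₁ C₂ p q n h ≫ (S.tensor C₁ C₂).d n n' =
      (S.T.map (C₁.d p p')).app (C₂.X q) ≫ S.ι C₁ C₂ p' q n' (by lia) +
      Int.negOnePow p • ((S.T.obj (C₁.X p)).map (C₂.d q q') ≫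
        S.ι C₁ C₂ p q' n' (by lia)) := by
  rw [HomologicalComplex.mapBifunctor.d_eq, Preadditive.comp_add,
    HomologicalComplex.mapBifunctor.ι_D₁, HomologicalComplex.mapBifunctor.ι_D₂,
    HomologicalComplex.mapBifunctor.d₁_eq C₁ C₂ S.T (ComplexShape.down ℤ)
      (show (ComplexShape.down ℤ).Rel p p' from hp) q n' (show p' + q = n' by lia),
    HomologicalComplex.mapBifunctor.d₂_eq C₁ C₂ S.T (ComplexShape.down ℤ) p
      (show (ComplexShape.down ℤ).Rel q q' from hq) n' (show p + q' = n' by lia)]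
  congr 1
  exact one_smul ℤˣ _

/-- The component `T(Z_p(C₁), Z_q(C₂)) ⟶ Z_n(T(C₁, C₂))` of the morphism
`z : T(Z(C₁), Z(C₂)) ⟶ Z(T(C₁, C₂))` induced by the inclusions of cycles. -/
def cyclesMap (p q n : ℤ) (h : p + q = n) :
    (S.T.obj (C₁.cycles p)).obj (C₂.cycles q) ⟶ (S.tensor C₁ C₂).cycles n :=
  (S.tensor C₁ C₂).liftCycles
    ((S.T.map (C₁.iCycles p)).app (C₂.cycles q) ≫
      (S.T.obj (C₁.X p)).map (C₂.iCycles q) ≫ S.ι C₁ C₂ p q n h) (n - 1) (by simp) (by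
    rw [Category.assoc, Category.assoc,
      S.ι_d C₁ C₂ p q n (p - 1) (q - 1) (n - 1) h (by lia) (by lia) (by lia)]
    have h₁ : (S.T.map (C₁.iCycles p)).app (C₂.cycles q) ≫
        (S.T.map (C₁.d p (p - 1))).app (C₂.cycles q) = 0 := by
      rw [← NatTrans.comp_app, ← Functor.map_comp, C₁.iCycles_d, Functor.map_zero, zero_app]
    have h₂ : (S.T.obj (C₁.X p)).map (C₂.iCycles q) ≫
        (S.T.obj (C₁.X p)).map (C₂.d q (q - 1)) = 0 := by
      rw [← Functor.map_comp, C₂.iCycles_d, Functor.map_zero]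
    rw [Preadditive.comp_add, Linear.comp_units_smul, NatTrans.naturality_assoc,
      reassoc_of% h₂, zero_comp, smul_zero, add_zero, reassoc_of% h₁, zero_comp])

lemma cyclesMap_i (p q n : ℤ) (h : p + q = n) :
    S.cyclesMap C₁ C₂ p q n h ≫ (S.tensor C₁ C₂).iCycles n =
      (S.T.map (C₁.iCycles p)).app (C₂.cycles q) ≫
        (S.T.obj (C₁.X p)).map (C₂.iCycles q) ≫ S.ι C₁ C₂ p q n h :=
  HomologicalComplex.liftCycles_i _ _ _ _ _

instance isLeftAdjoint_right (X₁ : A₁) : (S.T.obj X₁).IsLeftAdjoint :=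
  (S.adjCot.adj X₁).isLeftAdjoint

instance isLeftAdjoint_left (X₂ : A₂) : (S.T.flip.obj X₂).IsLeftAdjoint :=
  (S.adjHom.adj X₂).isLeftAdjoint

instance additive_flip (X₂ : A₂) : (S.T.flip.obj X₂).Additive where
  map_add {X Y f g} := by
    change (S.T.map (f + g)).app X₂ = (S.T.map f).app X₂ + (S.T.map g).app X₂
    rw [Functor.map_add, NatTrans.app_add]

lemma map_toCycles_cyclesMap (p q n : ℤ) (h : p + q = n) :
    (S.T.flip.obj (C₂.cycles q)).map (C₁.toCycles (p + 1) p) ≫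
      S.cyclesMap C₁ C₂ p q n h ≫ (S.tensor C₁ C₂).homologyπ n = 0 := by
  have key : (S.T.flip.obj (C₂.cycles q)).map (C₁.toCycles (p + 1) p) ≫
      S.cyclesMap C₁ C₂ p q n h =
      ((S.T.obj (C₁.X (p + 1))).map (C₂.iCycles q) ≫ S.ι C₁ C₂ (p + 1) q (n + 1) (by lia)) ≫
        (S.tensor C₁ C₂).toCycles (n + 1) n := by
    rw [← cancel_mono ((S.tensor C₁ C₂).iCycles n), Category.assoc, Category.assoc,
      cyclesMap_i, HomologicalComplex.toCycles_i, Category.assoc,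
      S.ι_d C₁ C₂ (p + 1) q (n + 1) p (q - 1) n (by lia) rfl (by lia) rfl]
    have h₁ : (S.T.flip.obj (C₂.cycles q)).map (C₁.toCycles (p + 1) p) ≫
        (S.T.map (C₁.iCycles p)).app (C₂.cycles q) =
        (S.T.map (C₁.d (p + 1) p)).app (C₂.cycles q) := by
      change (S.T.map (C₁.toCycles (p + 1) p)).app (C₂.cycles q) ≫ _ = _
      rw [← NatTrans.comp_app, ← Functor.map_comp, HomologicalComplex.toCycles_i]
    have h₂ : (S.T.obj (C₁.X (p + 1))).map (C₂.iCycles q) ≫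
        (S.T.obj (C₁.X (p + 1))).map (C₂.d q (q - 1)) = 0 := by
      rw [← Functor.map_comp, C₂.iCycles_d, Functor.map_zero]
    rw [reassoc_of% h₁, Preadditive.comp_add, Linear.comp_units_smul, reassoc_of% h₂, zero_comp,
      smul_zero, add_zero, NatTrans.naturality_assoc]
  rw [reassoc_of% key, HomologicalComplex.toCycles_comp_homologyπ, comp_zero, comp_zero]

lemma cyclesMap_toCycles (p q n : ℤ) (h : p + q = n) :
    (S.T.obj (C₁.cycles p)).map (C₂.toCycles (q + 1) q) ≫
      S.cyclesMap C₁ C₂ p q n h ≫ (S.tensor C₁ C₂).homologyπ n = 0 := by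
  have key : (S.T.obj (C₁.cycles p)).map (C₂.toCycles (q + 1) q) ≫
      S.cyclesMap C₁ C₂ p q n h =
      Int.negOnePow p • (((S.T.map (C₁.iCycles p)).app (C₂.X (q + 1)) ≫
        S.ι C₁ C₂ p (q + 1) (n + 1) (by lia)) ≫ (S.tensor C₁ C₂).toCycles (n + 1) n) := by
    rw [← cancel_mono ((S.tensor C₁ C₂).iCycles n), Category.assoc, Linear.units_smul_comp,
      Category.assoc, cyclesMap_i, HomologicalComplex.toCycles_i, Category.assoc,
      S.ι_d C₁ C₂ p (q + 1) (n + 1) (p - 1) q n (by lia) (by lia) rfl rfl]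
    have h₁ : (S.T.map (C₁.iCycles p)).app (C₂.X (q + 1)) ≫
        (S.T.map (C₁.d p (p - 1))).app (C₂.X (q + 1)) = 0 := by
      rw [← NatTrans.comp_app, ← Functor.map_comp, C₁.iCycles_d, Functor.map_zero, zero_app]
    rw [Preadditive.comp_add, Linear.comp_units_smul, reassoc_of% h₁, zero_comp, zero_add,
      smul_smul, Int.units_mul_self, one_smul, ← NatTrans.naturality_assoc,
      ← NatTrans.naturality_assoc, ← Functor.map_comp_assoc, HomologicalComplex.toCycles_i]
  rw [reassoc_of% key, Linear.units_smul_comp, Category.assoc, Category.assoc,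
    HomologicalComplex.toCycles_comp_homologyπ, comp_zero, comp_zero, smul_zero]

/-- The morphism `T(H_p(C₁), Z_q(C₂)) ⟶ H_n(T(C₁, C₂))` induced by `cyclesMap`. -/
def γAux (p q n : ℤ) (h : p + q = n) :
    (S.T.obj (C₁.homology p)).obj (C₂.cycles q) ⟶ (S.tensor C₁ C₂).homology n :=
  descHomology (S.T.flip.obj (C₂.cycles q)) C₁ p
    (S.cyclesMap C₁ C₂ p q n h ≫ (S.tensor C₁ C₂).homologyπ n)
    (S.map_toCycles_cyclesMap C₁ C₂ p q n h)

lemma π_γAux (p q n : ℤ) (h : p + q = n) :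
    (S.T.map (C₁.homologyπ p)).app (C₂.cycles q) ≫ S.γAux C₁ C₂ p q n h =
      S.cyclesMap C₁ C₂ p q n h ≫ (S.tensor C₁ C₂).homologyπ n :=
  π_descHomology (S.T.flip.obj (C₂.cycles q)) C₁ p _ _

instance epi_map_app {X Y : A₁} (f : X ⟶ Y) [Epi f] (X₂ : A₂) : Epi ((S.T.map f).app X₂) :=
  inferInstanceAs (Epi ((S.T.flip.obj X₂).map f))

lemma toCycles_γAux (p q n : ℤ) (h : p + q = n) :
    (S.T.obj (C₁.homology p)).map (C₂.toCycles (q + 1) q) ≫ S.γAux C₁ C₂ p q n h = 0 := by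
  rw [← cancel_epi ((S.T.map (C₁.homologyπ p)).app (C₂.X (q + 1))), comp_zero,
    ← NatTrans.naturality_assoc, π_γAux, cyclesMap_toCycles]

/-- The component `T(H_p(C₁), H_q(C₂)) ⟶ H_n(T(C₁, C₂))` of `γ`. -/
def γComponent (p q n : ℤ) (h : p + q = n) :
    (S.T.obj (C₁.homology p)).obj (C₂.homology q) ⟶ (S.tensor C₁ C₂).homology n :=
  descHomology (S.T.obj (C₁.homology p)) C₂ q (S.γAux C₁ C₂ p q n h)
    (S.toCycles_γAux C₁ C₂ p q n h)

/-- `γ` is the morphism such that `γ ∘ T(p', p) = p'' ∘ z`, where `p'`, `p`, `p''` are the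
projections from cycles to homology, and `z : T(Z(C₁), Z(C₂)) ⟶ Z(T(C₁, C₂))`. -/
lemma π_γComponent (p q n : ℤ) (h : p + q = n) :
    (S.T.map (C₁.homologyπ p)).app (C₂.cycles q) ≫
      (S.T.obj (C₁.homology p)).map (C₂.homologyπ q) ≫ S.γComponent C₁ C₂ p q n h =
      S.cyclesMap C₁ C₂ p q n h ≫ (S.tensor C₁ C₂).homologyπ n := by
  have h₂ : (S.T.obj (C₁.homology p)).map (C₂.homologyπ q) ≫ S.γComponent C₁ C₂ p q n h =
      S.γAux C₁ C₂ p q n h := π_descHomology _ _ _ _ _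
  rw [h₂, π_γAux]

lemma tensor_zeroComplex_d (X₁ : ℤ → A₁) (X₂ : ℤ → A₂) (n n' : ℤ) (hn : n' + 1 = n) :
    (S.tensor (zeroComplex X₁) (zeroComplex X₂)).d n n' = 0 := by
  apply HomologicalComplex.mapBifunctor.hom_ext
  intro p q h
  rw [comp_zero]
  refine (S.ι_d _ _ p q n (p - 1) (q - 1) n' h (by lia) (by lia) hn).trans ?_
  have h₁ : S.T.map ((zeroComplex X₁).d p (p - 1)) = 0 := S.T.map_zero _ _
  have h₂ : (S.T.obj ((zeroComplex X₁).X p)).map ((zeroComplex X₂).d q (q - 1)) = 0 :=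
    Functor.map_zero _ _ _
  rw [h₁, h₂, zero_app, zero_comp, zero_comp, smul_zero, add_zero]

/-- The natural morphism `γ : T(H(C₁), H(C₂)) ⟶ H(T(C₁, C₂))`, where homology is regarded as
a complex with zero differential. It is characterized by `π_γComponent` on each summand. -/
def γ : S.tensor (homologyComplex C₁) (homologyComplex C₂) ⟶
    homologyComplex (S.tensor C₁ C₂) where
  f n := HomologicalComplex.mapBifunctorDesc (fun p q h => S.γComponent C₁ C₂ p q n h)
  comm' n n' hn := by
    rw [S.tensor_zeroComplex_d _ _ n n' hn, zero_comp]
    exact comp_zero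

lemma ι_γ (p q n : ℤ) (h : p + q = n) :
    S.ι (homologyComplex C₁) (homologyComplex C₂) p q n h ≫ (S.γ C₁ C₂).f n =
      S.γComponent C₁ C₂ p q n h :=
  HomologicalComplex.ι_mapBifunctorDesc (K₁ := homologyComplex C₁) (K₂ := homologyComplex C₂)
    (F := S.T) (c := ComplexShape.down ℤ) (fun p q h => S.γComponent C₁ C₂ p q n h) p q h

/-- `Tor_n(X₁, X₂) = H_n(T(R₁, R₂))`, for complete flat resolutions `R₁` of `X₁`
and `R₂` of `X₂`. -/
def tor {X₁ : A₁} {X₂ : A₂} (R₁ : CompleteResolution S.flat₁ X₁)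
    (R₂ : CompleteResolution S.flat₂ X₂) (n : ℤ) : A₃ :=
  (S.tensor R₁.complex R₂.complex).homology n

/-- `Tor₁(H(C₁), H(C₂))`: the complex with zero differential which in degree `n` is the coproduct
of the `Tor₁(H_p(C₁), H_{q-1}(C₂))` for `p + q = n`. -/
def torOneComplex (R₁ : ∀ p : ℤ, CompleteResolution S.flat₁ (C₁.homology p))
    (R₂ : ∀ q : ℤ, CompleteResolution S.flat₂ (C₂.homology q)) : ChainComplex A₃ ℤ :=
  zeroComplex (fun n => ∐ fun x : { x : ℤ × ℤ // x.1 + x.2 = n } =>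
    S.tor (R₁ x.1.1) (R₂ (x.1.2 - 1)) 1)

end BiadditiveTHC
end THCKunneth
end

/-!
The complexes `Z(C₂)` and `B(C₂)` of cycles and boundaries have zero differential and flat terms, so
`H(T(C₁, Z(C₂))) = T(H(C₁), Z(C₂))` and `H(T(C₁, B(C₂))) = T(H(C₁), B(C₂))`. As `A₁` has enough flat
objects and `B(C₂)` is flat, the snake lemma shows that the sequence
`T(C₁, Z(C₂)) ⟶ T(C₁, C₂) ⟶ T(C₁, B(C₂))` is short exact. Up to sign, the connecting morphism of its
long exact homology sequence is induced by the inclusion of the boundaries into the cycles of `C₂`.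
Its cokernel is `T(H(C₁), H(C₂))`, since `T` is right exact, and its kernel is `Tor₁`:
by a balancing argument `Tor₁` can be computed by resolving the first variable only, and a second
application of the snake lemma identifies it with the kernel of the morphism induced by a flat
presentation of the second variable.
-/

noncomputable section

namespace THCKunneth

section Resolutions

variable {A : Type u} [Category.{v} A] [Abelian A] {K : ObjectProperty A}

lemma rightPerp_of_isZero {X : A} (hX : IsZero X) : rightPerp K X :=
  fun _ _ _ _ _ _ => ⟨0, hX.eq_of_tgt _ _⟩

lemma leftPerp_of_isZero {X : A} (hX : IsZero X) : leftPerp K X :=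
  fun _ _ _ _ _ _ => ⟨0, hX.eq_of_src _ _⟩

lemma rightPerp_of_iso {X Y : A} (e : X ≅ Y) (hX : rightPerp K X) : rightPerp K Y := by
  intro V W i _ hi f
  obtain ⟨g, hg⟩ := hX i hi (f ≫ e.inv)
  exact ⟨g ≫ e.hom, by rw [reassoc_of% hg, e.inv_hom_id, Category.comp_id]⟩

lemma rightPerp_image {X Y Z : A} {e : X ⟶ Y} {m : Y ⟶ Z} {f : X ⟶ Z} (_ : Epi e) (_ : Mono m)
    (hf : f = e ≫ m) (hY : rightPerp K Y) : rightPerp K (image f) :=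
  have := strongEpi_of_epi e
  rightPerp_of_iso (image.isoStrongEpiMono e m hf.symm) hY

lemma exact_of_epi_comp_of_comp_mono {S : ShortComplex A} {X Z : A} {e : S.X₁ ⟶ X} (he : Epi e)
    {f : X ⟶ S.X₂} {g : S.X₂ ⟶ Z} {m : Z ⟶ S.X₃} (hm : Mono m) {w : f ≫ g = 0}
    (h : (ShortComplex.mk f g w).Exact) (hf : S.f = e ≫ f) (hg : S.g = g ≫ m) : S.Exact := by
  rw [ShortComplex.exact_iff_exact_up_to_refinements]
  intro W y hy
  have hyg : y ≫ g = 0 := by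
    rw [← cancel_mono m, Category.assoc, ← hg, hy, zero_comp]
  obtain ⟨W', a, _, x, hx : a ≫ y = x ≫ f⟩ := h.exact_up_to_refinements y hyg
  obtain ⟨W'', b, _, x', hx'⟩ := surjective_up_to_refinements_of_epi e x
  exact ⟨W'', b ≫ a, inferInstance, x', by
    rw [Category.assoc, hx, hf, reassoc_of% hx']⟩

section Augmentation

variable {R : ChainComplex A ℤ} {M : A}

/-- The component in degree `0` of a morphism to `M` placed in degree `0`. -/
def augmentation (π : R ⟶ (HomologicalComplex.single A (ComplexShape.down ℤ) 0).obj M) :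
    R.X 0 ⟶ M :=
  π.f 0 ≫ (HomologicalComplex.singleObjXSelf (ComplexShape.down ℤ) 0 M).hom

variable (π : R ⟶ (HomologicalComplex.single A (ComplexShape.down ℤ) 0).obj M)

lemma d_augmentation : R.d 1 0 ≫ augmentation π = 0 := by
  rw [augmentation, ← π.comm_assoc, HomologicalComplex.single_obj_d, zero_comp, comp_zero]

lemma quasiIsoAt_zero_iff (hR : IsZero (R.X (-1))) :
    QuasiIsoAt π 0 ↔
      (ShortComplex.mk _ _ (d_augmentation π)).Exact ∧ Epi (augmentation π) := by
  let e := HomologicalComplex.singleObjXSelf (ComplexShape.down ℤ) 0 M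
  rw [quasiIsoAt_iff' _ 1 0 (-1) (by simp) (by simp),
    ShortComplex.quasiIso_iff_of_zeros' _ (hR.eq_of_tgt _ _)
      (HomologicalComplex.single_obj_d (ComplexShape.down ℤ) _ _ _ _)
      (HomologicalComplex.single_obj_d (ComplexShape.down ℤ) _ _ _ _)]
  refine and_congr (ShortComplex.exact_iff_of_iso (ShortComplex.isoMk (Iso.refl _) (Iso.refl _)
    e ((Category.id_comp _).trans (Category.comp_id _).symm) (Category.id_comp _))) ?_
  exact ((MorphismProperty.epimorphisms A).cancel_right_of_respectsIso (π.f 0) e.hom).symm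

/-- The morphism to `M` placed in degree `0` with a prescribed augmentation. -/
def toSingle (ε : R.X 0 ⟶ M) (w : R.d 1 0 ≫ ε = 0) :
    R ⟶ (HomologicalComplex.single A (ComplexShape.down ℤ) 0).obj M :=
  HomologicalComplex.mkHomToSingle ε fun j hj => by
    obtain rfl : j = 1 := hj.symm
    exact w

lemma augmentation_toSingle (ε : R.X 0 ⟶ M) (w : R.d 1 0 ≫ ε = 0) :
    augmentation (toSingle ε w) = ε := by
  rw [augmentation, toSingle, HomologicalComplex.mkHomToSingle_f, Category.assoc,
    Iso.inv_hom_id, Category.comp_id]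

end Augmentation

section Splice

variable {M U : ℕ → A}

open ZeroObject in
variable (U) in
/-- The objects of the complex `splice`. -/
def spliceX : ℤ → A
  | Int.ofNat n => U n
  | Int.negSucc _ => 0

/-- The differentials of the complex `splice`. -/
def spliceD (i : ∀ n, M (n + 1) ⟶ U n) (p : ∀ n, U n ⟶ M n) :
    ∀ n : ℤ, spliceX U (n + 1) ⟶ spliceX U n
  | Int.ofNat n => p (n + 1) ≫ i n
  | Int.negSucc _ => 0

variable {i : ∀ n, M (n + 1) ⟶ U n} {p : ∀ n, U n ⟶ M n} (w : ∀ n, i n ≫ p n = 0)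

/-- The chain complex `⋯ ⟶ U 1 ⟶ U 0 ⟶ 0 ⟶ ⋯` obtained by splicing the short exact sequences
`0 ⟶ M (n + 1) ⟶ U n ⟶ M n ⟶ 0`. -/
def splice : ChainComplex A ℤ :=
  ChainComplex.of (spliceX U) (spliceD i p) fun
    | Int.ofNat n => by
      change (p (n + 2) ≫ i (n + 1)) ≫ (p (n + 1) ≫ i n) = 0
      rw [Category.assoc, reassoc_of% w, zero_comp, comp_zero]
    | Int.negSucc _ => comp_zero

lemma splice_d (n : ℕ) : (splice w).d (n + 1) n = p (n + 1) ≫ i n :=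
  ChainComplex.of_d (spliceX U) (spliceD i p) (n : ℤ)

lemma isZero_splice_X : ∀ n : ℤ, n < 0 → IsZero ((splice w).X n)
  | Int.ofNat n, hn => absurd hn (Int.natCast_nonneg n).not_gt
  | Int.negSucc _, _ => isZero_zero A

lemma splice_d_comp : (splice w).d 1 0 ≫ p 0 = 0 :=
  (splice_d w 0 =≫ p 0).trans ((Category.assoc _ _ _).trans ((p 1 ≫= w 0).trans comp_zero))

/-- The augmentation `splice w ⟶ M 0`. -/
def spliceπ : splice w ⟶ (HomologicalComplex.single A (ComplexShape.down ℤ) 0).obj (M 0) :=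
  toSingle (p 0) (splice_d_comp w)

lemma augmentation_spliceπ : augmentation (spliceπ w) = p 0 :=
  augmentation_toSingle (R := splice w) (p 0) (splice_d_comp w)

lemma spliceX_mem (hK : ∀ Z, IsZero Z → K Z) (hU : ∀ n, K (U n)) (n : ℤ) :
    K ((splice w).X n) :=
  match n with
  | Int.ofNat n => hU n
  | Int.negSucc _ => hK _ (isZero_zero A)

variable (hS : ∀ n, (ShortComplex.mk _ _ (w n)).ShortExact)

include hS

lemma splice_exactAt {n : ℤ} (hn : n ≠ 0) : (splice w).ExactAt n := by
  obtain hneg | hpos := lt_or_gt_of_ne hn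
  · exact HomologicalComplex.ExactAt.of_isZero (isZero_splice_X w n hneg)
  · obtain ⟨m, rfl⟩ : ∃ m : ℕ, n = m + 1 := ⟨(n - 1).toNat, by lia⟩
    rw [(splice w).exactAt_iff' (m + 1 + 1) (m + 1) m (by simp) (by simp)]
    exact exact_of_epi_comp_of_comp_mono (hS (m + 2)).epi_g (hS m).mono_f (hS (m + 1)).exact
      (splice_d w (m + 1)) (splice_d w m)

lemma quasiIsoAt_zero_spliceπ : QuasiIsoAt (spliceπ w) 0 := by
  rw [quasiIsoAt_zero_iff _ (isZero_splice_X w _ neg_one_lt_zero)]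
  refine ⟨exact_of_epi_comp_of_comp_mono (hS 1).epi_g (inferInstanceAs (Mono (𝟙 (M 0))))
    (hS 0).exact (splice_d w 0) ((augmentation_spliceπ w).trans (Category.comp_id _).symm), ?_⟩
  rw [augmentation_spliceπ]
  exact (hS 0).epi_g

lemma quasiIso_spliceπ : QuasiIso (spliceπ w) where
  quasiIsoAt n := by
    by_cases hn : n = 0
    · subst hn
      exact quasiIsoAt_zero_spliceπ w hS
    · rw [quasiIsoAt_iff_exactAt' _ _ (HomologicalComplex.exactAt_single_obj _ _ _ _ hn)]
      exact splice_exactAt w hS hn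

lemma rightPerp_boundaries_splice (hM : ∀ n, rightPerp K (M (n + 1))) (n : ℤ) :
    rightPerp K (boundaries (splice w) n) := by
  obtain n | n := n
  · exact rightPerp_image (hS (n + 1)).epi_g (hS n).mono_f (splice_d w n) (hM n)
  · exact rightPerp_of_isZero ((isZero_splice_X w _ (Int.negSucc_lt_zero n)).of_mono (image.ι _))

end Splice

/-- The complete resolution obtained by splicing short exact sequences. -/
def spliceResolution {M U : ℕ → A} {i : ∀ n, M (n + 1) ⟶ U n} {p : ∀ n, U n ⟶ M n}
    (w : ∀ n, i n ≫ p n = 0) (hS : ∀ n, (ShortComplex.mk _ _ (w n)).ShortExact)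
    (hK : ∀ Z, IsZero Z → K Z) (hU : ∀ n, K (U n)) (hM : ∀ n, rightPerp K (M (n + 1))) :
    CompleteResolution K (M 0) where
  complex := splice w
  mem := spliceX_mem w hK hU
  isZero := isZero_splice_X w
  π := spliceπ w
  quasiIso := quasiIso_spliceπ w hS
  boundaries_mem := rightPerp_boundaries_splice w hS hM

lemma IsLeftCompleteCotorsionTheory.nonempty_completeResolution
    (h : IsLeftCompleteCotorsionTheory K (rightPerp K)) (M : A) :
    Nonempty (CompleteResolution K M) := by
  choose Ω P i p w hΩ hP hS using h.exists_shortExact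
  let N : ℕ → A := Nat.rec M fun _ => Ω
  refine ⟨spliceResolution (M := N) (fun n => w (N n)) (fun n => hS (N n)) (fun Z hZ => ?_)
    (fun n => hP (N n)) (fun n => hΩ (N n))⟩
  rw [h.left_eq]
  exact leftPerp_of_isZero hZ

end Resolutions

lemma isZero_of_comp_eq_zero {A : Type u} [Category.{v} A] [Abelian A] {X Y Z : A}
    (f : X ⟶ Y) [Mono f] (g : Y ⟶ Z) [Mono g] (w : f ≫ g = 0) : IsZero X :=
  IsZero.of_mono_eq_zero f (zero_of_comp_mono g w)

namespace BiadditiveTHC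

variable {A₁ : Type u₁} {A₂ : Type u₂} {A₃ : Type u₃}
  [Category.{v₁} A₁] [Category.{v₂} A₂] [Category.{v₃} A₃]
  [Abelian A₁] [Abelian A₂] [Abelian A₃]
  (S : BiadditiveTHC A₁ A₂ A₃)

section Exactness

instance preservesColimits_right (X₁ : A₁) : PreservesColimits (S.T.obj X₁) :=
  (Adjunction.ofIsLeftAdjoint (S.T.obj X₁)).leftAdjoint_preservesColimits

instance preservesColimits_left (X₂ : A₂) : PreservesColimits (S.T.flip.obj X₂) :=
  (Adjunction.ofIsLeftAdjoint (S.T.flip.obj X₂)).leftAdjoint_preservesColimits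

variable {S} in
lemma flat₁.preservesHomology {X₁ : A₁} (h : S.flat₁ X₁) : (S.T.obj X₁).PreservesHomology :=
  have : (S.T.obj X₁).PreservesMonomorphisms := ⟨fun f _ => h f⟩
  (S.T.obj X₁).preservesHomology_of_preservesMonos_and_cokernels

variable {S} in
lemma flat₂.preservesHomology {X₂ : A₂} (h : S.flat₂ X₂) :
    (S.T.flip.obj X₂).PreservesHomology :=
  have : (S.T.flip.obj X₂).PreservesMonomorphisms := ⟨fun f _ => h f⟩
  (S.T.flip.obj X₂).preservesHomology_of_preservesMonos_and_cokernels

lemma map_comp_map_app {X Y Z : A₁} {f : X ⟶ Y} {g : Y ⟶ Z} (w : f ≫ g = 0) (X₂ : A₂) :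
    (S.T.map f).app X₂ ≫ (S.T.map g).app X₂ = 0 := by
  rw [← NatTrans.comp_app, ← Functor.map_comp, w, Functor.map_zero, zero_app]

lemma map_obj_comp_map_obj (X₁ : A₁) {X Y Z : A₂} {f : X ⟶ Y} {g : Y ⟶ Z} (w : f ≫ g = 0) :
    (S.T.obj X₁).map f ≫ (S.T.obj X₁).map g = 0 := by
  rw [← Functor.map_comp, w, Functor.map_zero]

lemma exact_map_right (X₁ : A₁) {F : ShortComplex A₂} (hF : F.Exact) (hg : Epi F.g) :
    (F.map (S.T.obj X₁)).Exact :=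
  hF.map_of_epi_of_preservesCokernel _ hg inferInstance

lemma exact_map_left (X₂ : A₂) {E : ShortComplex A₁} (hE : E.Exact) (hg : Epi E.g) :
    (E.map (S.T.flip.obj X₂)).Exact :=
  hE.map_of_epi_of_preservesCokernel _ hg inferInstance

end Exactness

section Snake

variable {E : ShortComplex A₁} {F : ShortComplex A₂}

/-- The snake diagram from the row `T(E₁, F)` to the row `T(E₂, F)`, whose cokernel row is
`T(E₃, F)`. -/
def snakeInput (hE : E.ShortExact) (hP : S.flat₁ E.X₂) (hF : F.ShortExact) :
    ShortComplex.SnakeInput A₃ where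
  L₀ := kernel (F.mapNatTrans (S.T.map E.f))
  L₁ := F.map (S.T.obj E.X₁)
  L₂ := F.map (S.T.obj E.X₂)
  L₃ := F.map (S.T.obj E.X₃)
  v₀₁ := kernel.ι _
  v₁₂ := F.mapNatTrans (S.T.map E.f)
  v₂₃ := F.mapNatTrans (S.T.map E.g)
  w₀₂ := kernel.condition _
  w₁₃ := by ext <;> exact S.map_comp_map_app E.zero _
  h₀ := kernelIsKernel _
  h₃ := by
    have (Y : A₂) : Epi (E.map (S.T.flip.obj Y)).g :=
      have := hE.epi_g
      inferInstanceAs (Epi ((S.T.flip.obj Y).map E.g))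
    have isCokernel (Y : A₂) := (S.exact_map_left Y hE.exact hE.epi_g).gIsCokernel
    exact ShortComplex.isColimitOfIsColimitπ _
      ((CokernelCofork.isColimitMapCoconeEquiv _ _).2 (isCokernel F.X₁))
      ((CokernelCofork.isColimitMapCoconeEquiv _ _).2 (isCokernel F.X₂))
      ((CokernelCofork.isColimitMapCoconeEquiv _ _).2 (isCokernel F.X₃))
  L₁_exact := S.exact_map_right _ hF.exact hF.epi_g
  epi_L₁_g :=
    have := hF.epi_g
    inferInstanceAs (Epi ((S.T.obj E.X₁).map F.g))
  L₂_exact := S.exact_map_right _ hF.exact hF.epi_g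
  mono_L₂_f :=
    have := hF.mono_f
    hP F.f

lemma mono_map_of_flat₂ (hE : E.ShortExact) (hP : S.flat₁ E.X₂) (hF : F.ShortExact)
    (h : S.flat₂ F.X₃) : Mono ((S.T.obj E.X₃).map F.f) := by
  let D := S.snakeInput hE hP hF
  have := hE.mono_f
  have : Mono D.v₁₂.τ₃ := h E.f
  have hL₀ : IsZero D.L₀.X₃ := isZero_of_comp_eq_zero _ _ D.w₀₂_τ₃
  exact (D.L₂'.exact_iff_mono (hL₀.eq_zero_of_src _)).1 D.L₂'_exact

/-- The isomorphism is the connecting morphism of the snake lemma. -/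
lemma nonempty_kernel_iso (hE : E.ShortExact) (hP : S.flat₁ E.X₂) (hF : F.ShortExact)
    (h : S.flat₂ F.X₂) :
    Nonempty (kernel ((S.T.map E.f).app F.X₃) ≅ kernel ((S.T.obj E.X₃).map F.f)) := by
  let D := S.snakeInput hE hP hF
  have := hE.mono_f
  have : Mono D.v₁₂.τ₂ := h E.f
  have : Mono D.L₂'.f := D.mono_δ (isZero_of_comp_eq_zero _ _ D.w₀₂_τ₂)
  let e₁ := (kernelIsKernel D.v₁₂.τ₃).conePointUniqueUpToIso D.h₀τ₃
  let e₂ := D.L₂'_exact.fIsKernel.conePointUniqueUpToIso (kernelIsKernel D.L₃.f)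
  exact ⟨e₁ ≪≫ e₂⟩

end Snake

end BiadditiveTHC

section Coproducts

variable {A : Type u} [Category.{v} A] [Abelian A]

lemma exact_of_evaluation {J : Type u₁} [Category.{v₁} J] (S : ShortComplex (J ⥤ A))
    (hS : ∀ j, (S.map ((evaluation J A).obj j)).Exact) : S.Exact := by
  rw [ShortComplex.exact_iff_isZero_homology, Functor.isZero_iff]
  intro j
  exact ((ShortComplex.exact_iff_isZero_homology _).1 (hS j)).of_iso
    (S.mapHomologyIso ((evaluation J A).obj j)).symm

variable {J : Type u₁} [HasColimitsOfShape (Discrete J) A]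

section

variable [HasExactColimitsOfShape (Discrete J) A]

lemma mono_of_isColimit_cofan {X Y : J → A} {f : ∀ j, X j ⟶ Y j} (hf : ∀ j, Mono (f j))
    {X' Y' : A} {a : ∀ j, X j ⟶ X'} {b : ∀ j, Y j ⟶ Y'} (ha : IsColimit (Cofan.mk X' a))
    (hb : IsColimit (Cofan.mk Y' b)) (f' : X' ⟶ Y') (comm : ∀ j, a j ≫ f' = f j ≫ b j) :
    Mono f' := by
  let φ : Discrete.functor X ⟶ Discrete.functor Y := Discrete.natTrans (fun j => f j.as)
  have : ∀ j, Mono (φ.app j) := fun j => hf j.as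
  have : Mono φ := NatTrans.mono_of_mono_app φ
  exact colim.map_mono' φ ha hb f' (fun j => comm j.as)

variable {S : J → ShortComplex A} {X : ShortComplex A} (φ : ∀ j, S j ⟶ X)

lemma exact_of_isColimit_cofan (hS : ∀ j, (S j).Exact)
    (h₁ : IsColimit (Cofan.mk X.X₁ fun j => (φ j).τ₁))
    (h₂ : IsColimit (Cofan.mk X.X₂ fun j => (φ j).τ₂))
    (h₃ : IsColimit (Cofan.mk X.X₃ fun j => (φ j).τ₃)) : X.Exact := by
  let T : ShortComplex (Discrete J ⥤ A) :=
    { X₁ := Discrete.functor (fun j => (S j).X₁)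
      X₂ := Discrete.functor (fun j => (S j).X₂)
      X₃ := Discrete.functor (fun j => (S j).X₃)
      f := Discrete.natTrans (fun j => (S j.as).f)
      g := Discrete.natTrans (fun j => (S j.as).g)
      zero := by
        ext j
        exact (S j.as).zero }
  have hT : T.Exact := exact_of_evaluation T (fun j => hS j.as)
  exact colim.exact_mapShortComplex hT h₁ h₂ h₃ X.f X.g
    (fun j => (φ j.as).comm₁₂) (fun j => (φ j.as).comm₂₃)

/-- Exact coproducts commute with kernels. -/
def isColimitCofanτ₁ (hS : ∀ j, (S j).Exact) (hf : ∀ j, Mono (S j).f) (hX : X.Exact)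
    (hXf : Mono X.f) (h₂ : IsColimit (Cofan.mk X.X₂ fun j => (φ j).τ₂))
    (h₃ : IsColimit (Cofan.mk X.X₃ fun j => (φ j).τ₃)) :
    IsColimit (Cofan.mk X.X₁ fun j => (φ j).τ₁) := by
  let t : (∐ fun j => (S j).X₁) ⟶ X.X₁ := Sigma.desc fun j => (φ j).τ₁
  have ht (j : J) : Sigma.ι (fun j => (S j).X₁) j ≫ t ≫ X.f = (S j).f ≫ (φ j).τ₂ := by
    rw [Sigma.ι_desc_assoc, (φ j).comm₁₂]
  let X' : ShortComplex A := .mk (t ≫ X.f) X.g (by rw [Category.assoc, X.zero, comp_zero])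
  let φ' (j : J) : S j ⟶ X' :=
    { τ₁ := Sigma.ι (fun j => (S j).X₁) j
      τ₂ := (φ j).τ₂
      τ₃ := (φ j).τ₃
      comm₁₂ := ht j
      comm₂₃ := (φ j).comm₂₃ }
  have hX' : X'.Exact :=
    exact_of_isColimit_cofan φ' hS (coproductIsCoproduct fun j => (S j).X₁) h₂ h₃
  have : Mono X'.f := mono_of_isColimit_cofan hf (coproductIsCoproduct _) h₂ _ ht
  let e := hX'.fIsKernel.conePointUniqueUpToIso hX.fIsKernel
  have he : e.hom = t := by
    rw [← cancel_mono X.f]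
    exact hX'.fIsKernel.conePointUniqueUpToIso_hom_comp hX.fIsKernel .zero
  exact IsColimit.ofIsoColimit (coproductIsCoproduct _)
    (Cofan.ext e fun j => (congrArg (_ ≫ ·) he).trans (Sigma.ι_desc _ j))

end

/-- Coproducts commute with cokernels. -/
def isColimitCofanτ₃ {S : J → ShortComplex A} {X : ShortComplex A} (φ : ∀ j, S j ⟶ X)
    (hg : ∀ j, Epi (S j).g) (hX : X.Exact) (hXg : Epi X.g)
    (h₁ : IsColimit (Cofan.mk X.X₁ fun j => (φ j).τ₁))
    (h₂ : IsColimit (Cofan.mk X.X₂ fun j => (φ j).τ₂)) :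
    IsColimit (Cofan.mk X.X₃ fun j => (φ j).τ₃) := by
  let a (s : Cofan fun j => (S j).X₃) : X.X₂ ⟶ s.pt :=
    Cofan.IsColimit.desc h₂ fun j => (S j).g ≫ s.inj j
  have ha (s) (j) : (φ j).τ₂ ≫ a s = (S j).g ≫ s.inj j := Cofan.IsColimit.fac h₂ _ j
  have ha' (s) : X.f ≫ a s = 0 := by
    refine Cofan.IsColimit.hom_ext h₁ _ _ fun j => ?_
    change (φ j).τ₁ ≫ X.f ≫ a s = (φ j).τ₁ ≫ 0
    rw [(φ j).comm₁₂_assoc, ha, (S j).zero_assoc, zero_comp, comp_zero]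
  refine Cofan.IsColimit.mk _ (fun s => hX.desc (a s) (ha' s)) (fun s j => ?_)
    (fun s m hm => ?_)
  · change (φ j).τ₃ ≫ hX.desc (a s) (ha' s) = s.inj j
    rw [← cancel_epi (S j).g, ← (φ j).comm₂₃_assoc, hX.g_desc, ha]
  · rw [← cancel_epi X.g, hX.g_desc]
    refine Cofan.IsColimit.hom_ext h₂ _ _ fun j => ?_
    change (φ j).τ₂ ≫ X.g ≫ m = (φ j).τ₂ ≫ a s
    rw [(φ j).comm₂₃_assoc, ha, ← hm j]
    rfl

end Coproducts

/-- The bidegrees `(p, q)` of total degree `n`. -/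
abbrev Bidegree (n : ℤ) : Type := {x : ℤ × ℤ // x.1 + x.2 = n}

namespace BiadditiveTHC

section Tensor

variable {A₁ : Type u₁} {A₂ : Type u₂} {A₃ : Type u₃}
  [Category.{v₁} A₁] [Category.{v₂} A₂] [Category.{v₃} A₃]
  [Abelian A₁] [Abelian A₂] [Abelian A₃]
  (S : BiadditiveTHC A₁ A₂ A₃) [HasColimits A₃]
  (C₁ : ChainComplex A₁ ℤ) (C₂ : ChainComplex A₂ ℤ)

variable {C₁ C₂} in
lemma tensor_hom_ext {n : ℤ} {Y : A₃} {f g : (S.tensor C₁ C₂).X n ⟶ Y}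
    (h : ∀ (p q : ℤ) (h : p + q = n), S.ι C₁ C₂ p q n h ≫ f = S.ι C₁ C₂ p q n h ≫ g) : f = g :=
  HomologicalComplex.mapBifunctor.hom_ext h

variable {C₁ C₂} in
lemma isZero_tensor_X {n : ℤ} (h : ∀ p q : ℤ, p + q = n → IsZero (C₁.X p) ∨ IsZero (C₂.X q)) :
    IsZero ((S.tensor C₁ C₂).X n) := by
  rw [IsZero.iff_id_eq_zero]
  refine S.tensor_hom_ext fun p q hpq => IsZero.eq_of_src ?_ _ _
  obtain hp | hq := h p q hpq
  · exact (S.T.flip.obj (C₂.X q)).map_isZero hp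
  · exact (S.T.obj (C₁.X p)).map_isZero hq

/-- The degree `n` term of `T(C₁, C₂)` as a coproduct. -/
def isColimitTensor (n : ℤ) :
    IsColimit (Cofan.mk ((S.tensor C₁ C₂).X n)
      fun x : Bidegree n => S.ι C₁ C₂ x.1.1 x.1.2 n x.2) :=
  Cofan.IsColimit.mk _
    (fun s => HomologicalComplex.mapBifunctorDesc fun p q h => s.inj ⟨(p, q), h⟩)
    (fun _ x => HomologicalComplex.ι_mapBifunctorDesc _ x.1.1 x.1.2 x.2)
    (fun _ _ hm => S.tensor_hom_ext fun p q h => by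
      rw [HomologicalComplex.ι_mapBifunctorDesc]
      exact hm ⟨(p, q), h⟩)

variable {K L : ChainComplex A₂ ℤ}

/-- The morphism `T(C₁, f)`. -/
abbrev tensorMap (f : K ⟶ L) : S.tensor C₁ K ⟶ S.tensor C₁ L :=
  HomologicalComplex.mapBifunctorMap (𝟙 C₁) f S.T (ComplexShape.down ℤ)

lemma ι_tensorMap (f : K ⟶ L) (p q n : ℤ) (h : p + q = n) :
    S.ι C₁ K p q n h ≫ (S.tensorMap C₁ f).f n =
      (S.T.obj (C₁.X p)).map (f.f q) ≫ S.ι C₁ L p q n h := by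
  refine (HomologicalComplex.ι_mapBifunctorMap _ _ _ _ p q n h).trans ?_
  rw [HomologicalComplex.id_f, CategoryTheory.Functor.map_id, NatTrans.id_app,
    Category.id_comp]

lemma epi_tensorMap_f (f : K ⟶ L) (hf : ∀ q, Epi (f.f q)) (n : ℤ) :
    Epi ((S.tensorMap C₁ f).f n) where
  left_cancellation a b hab := S.tensor_hom_ext fun p q h => by
    rw [← cancel_epi ((S.T.obj (C₁.X p)).map (f.f q))]
    have hι := S.ι_tensorMap C₁ f p q n h
    rw [← reassoc_of% hι, ← reassoc_of% hι, hab]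

/-- The sequence `T(C₁, F)`. -/
@[simps]
def tensorShortComplex (F : ShortComplex (ChainComplex A₂ ℤ)) :
    ShortComplex (ChainComplex A₃ ℤ) where
  X₁ := S.tensor C₁ F.X₁
  X₂ := S.tensor C₁ F.X₂
  X₃ := S.tensor C₁ F.X₃
  f := S.tensorMap C₁ F.f
  g := S.tensorMap C₁ F.g
  zero := by
    refine HomologicalComplex.hom_ext _ _ fun n => S.tensor_hom_ext fun p q h => ?_
    have w : F.f.f q ≫ F.g.f q = 0 := by
      rw [← HomologicalComplex.comp_f, F.zero, HomologicalComplex.zero_f]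
    rw [HomologicalComplex.comp_f, reassoc_of% (S.ι_tensorMap C₁ F.f p q n h), S.ι_tensorMap,
      reassoc_of% (S.map_obj_comp_map_obj _ w), zero_comp, HomologicalComplex.zero_f,
      comp_zero]

/-- The inclusion of `T(C₁, F)` in bidegree `(p, q)`. -/
@[simps]
def tensorShortComplexι (F : ShortComplex (ChainComplex A₂ ℤ)) (p q n : ℤ) (h : p + q = n) :
    (F.map (HomologicalComplex.eval A₂ _ q)).map (S.T.obj (C₁.X p)) ⟶
      (S.tensorShortComplex C₁ F).map (HomologicalComplex.eval A₃ _ n) where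
  τ₁ := S.ι C₁ F.X₁ p q n h
  τ₂ := S.ι C₁ F.X₂ p q n h
  τ₃ := S.ι C₁ F.X₃ p q n h
  comm₁₂ := S.ι_tensorMap C₁ F.f p q n h
  comm₂₃ := S.ι_tensorMap C₁ F.g p q n h

lemma shortExact_tensorShortComplex [CountableAB4 A₃] {F : ShortComplex (ChainComplex A₂ ℤ)}
    (hF : F.ShortExact) (hf : ∀ p q : ℤ, Mono ((S.T.obj (C₁.X p)).map (F.f.f q))) :
    (S.tensorShortComplex C₁ F).ShortExact := by
  refine HomologicalComplex.shortExact_of_degreewise_shortExact _ fun n => ?_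
  have hFq (q : ℤ) : (F.map (HomologicalComplex.eval A₂ _ q)).ShortExact := hF.map_of_exact _
  exact
    { exact := exact_of_isColimit_cofan
        (fun x : Bidegree n => S.tensorShortComplexι C₁ F x.1.1 x.1.2 n x.2)
        (fun x => S.exact_map_right (C₁.X x.1.1) (hFq x.1.2).exact (hFq x.1.2).epi_g)
        (S.isColimitTensor C₁ F.X₁ n) (S.isColimitTensor C₁ F.X₂ n)
        (S.isColimitTensor C₁ F.X₃ n)
      mono_f := mono_of_isColimit_cofan (fun x : Bidegree n => hf x.1.1 x.1.2)
        (S.isColimitTensor C₁ F.X₁ n) (S.isColimitTensor C₁ F.X₂ n) _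
        (fun x => S.ι_tensorMap C₁ F.f x.1.1 x.1.2 n x.2)
      epi_g := S.epi_tensorMap_f C₁ F.g (fun q => (hFq q).epi_g) n }

end Tensor

end BiadditiveTHC

section Disk

variable {A : Type u} [Category.{v} A] [Abelian A]

lemma acyclic_of_homotopy_id_zero {K : ChainComplex A ℤ} (h : Homotopy (𝟙 K) 0) : K.Acyclic :=
  fun n => (K.exactAt_iff_isZero_homology n).2 <| by
    rw [IsZero.iff_id_eq_zero, ← HomologicalComplex.homologyMap_id, h.homologyMap_eq,
      HomologicalComplex.homologyMap_zero]

/-- The contractible complex `X = X` in degrees `m + 1` and `m`. -/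
abbrev disk (X : A) (m : ℤ) : ChainComplex A ℤ :=
  HomologicalComplex.double (𝟙 X) (show (ComplexShape.down ℤ).Rel (m + 1) m from rfl)

abbrev diskXIso₀ (X : A) (m : ℤ) : (disk X m).X (m + 1) ≅ X :=
  HomologicalComplex.doubleXIso₀ _ _

abbrev diskXIso₁ (X : A) (m : ℤ) : (disk X m).X m ≅ X :=
  HomologicalComplex.doubleXIso₁ _ _ (by simp)

lemma disk_d (X : A) (m : ℤ) :
    (disk X m).d (m + 1) m = (diskXIso₀ X m).hom ≫ (diskXIso₁ X m).inv := by
  rw [HomologicalComplex.double_d _ _ (by simp), Category.id_comp]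

/-- The contracting homotopy of `disk X m`. -/
def diskHomotopy (X : A) (m : ℤ) : Homotopy (𝟙 (disk X m)) 0 :=
  let h (i j : ℤ) (_ : (ComplexShape.down ℤ).Rel j i) : (disk X m).X i ⟶ (disk X m).X j :=
    if hi : i = m ∧ j = m + 1 then
      eqToHom (by rw [hi.1]) ≫ (diskXIso₁ X m).hom ≫ (diskXIso₀ X m).inv ≫ eqToHom (by rw [hi.2])
    else 0
  have rel (i : ℤ) : (ComplexShape.down ℤ).Rel (i + 1) i := rfl
  have hm : h m (m + 1) (rel m) = (diskXIso₁ X m).hom ≫ (diskXIso₀ X m).inv := by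
    simp only [h, and_self, dif_pos, eqToHom_refl, Category.id_comp, Category.comp_id]
  have hne (i j : ℤ) (hij) (hi : i ≠ m) : h i j hij = 0 := dif_neg (by tauto)
  have id_eq : 𝟙 (disk X m) = Homotopy.nullHomotopicMap' h := by
    refine HomologicalComplex.to_double_hom_ext ?_ ?_
    · rw [Homotopy.nullHomotopicMap'_f (rel (m + 1)) (rel m), hm,
        hne (m + 1) _ (rel (m + 1)) (by simp), zero_comp, add_zero, disk_d]
      simp
    · have rel' : (ComplexShape.down ℤ).Rel m (m - 1) := by simp
      rw [Homotopy.nullHomotopicMap'_f (rel m) rel', hm, hne (m - 1) m rel' (by simp), comp_zero,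
        zero_add, disk_d]
      simp
  (Homotopy.ofEq id_eq).trans (Homotopy.nullHomotopy' h)

variable (K : ChainComplex A ℤ) (m : ℤ)

/-- The morphism which is the identity in degree `m`. -/
def toDisk : K ⟶ disk (K.X m) m where
  f n :=
    if h₀ : n = m + 1 then
      eqToHom (by rw [h₀]) ≫ K.d (m + 1) m ≫ (diskXIso₀ (K.X m) m).inv ≫ eqToHom (by rw [h₀])
    else if h₁ : n = m then
      eqToHom (by rw [h₁]) ≫ (diskXIso₁ (K.X m) m).inv ≫ eqToHom (by rw [h₁])
    else 0
  comm' i j hij := by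
    obtain rfl : j + 1 = i := hij
    by_cases h₀ : j = m
    · subst h₀
      simp [disk_d]
    · rw [HomologicalComplex.double_d_eq_zero₁ _ _ _ _ h₀, comp_zero, dif_neg h₀]
      by_cases h₁ : j = m + 1
      · subst h₁
        simp
      · rw [dif_neg h₁, comp_zero]

lemma toDisk_f_succ : (toDisk K m).f (m + 1) = K.d (m + 1) m ≫ (diskXIso₀ (K.X m) m).inv := by
  simp [toDisk]

lemma toDisk_f : (toDisk K m).f m = (diskXIso₁ (K.X m) m).inv := by
  simp [toDisk]

variable {K m}

lemma epi_toDisk_f (hK : K.Acyclic) (hm : ∀ q < m, IsZero (K.X q)) (n : ℤ) :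
    Epi ((toDisk K m).f n) := by
  by_cases h₀ : n = m + 1
  · subst h₀
    have hexact := (K.exactAt_iff' (m + 1) m (m - 1) (by simp) (by simp)).1 (hK m)
    have : Epi (K.d (m + 1) m) := hexact.epi_f ((hm (m - 1) (by lia)).eq_zero_of_tgt _)
    rw [toDisk_f_succ]
    infer_instance
  by_cases h₁ : n = m
  · subst h₁
    rw [toDisk_f]
    infer_instance
  · exact (HomologicalComplex.isZero_double_X _ _ n h₀ h₁).epi _

lemma isZero_kernel_toDisk_X (hm : ∀ q < m, IsZero (K.X q)) (q : ℤ) (hq : q ≤ m) :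
    IsZero ((kernel (toDisk K m)).X q) := by
  have : Mono ((toDisk K m).f q) := by
    obtain hq | rfl := hq.lt_or_eq
    · exact (hm q hq).mono _
    · rw [toDisk_f]
      infer_instance
  refine isZero_of_comp_eq_zero ((kernel.ι (toDisk K m)).f q) ((toDisk K m).f q) ?_
  rw [← HomologicalComplex.comp_f, kernel.condition, HomologicalComplex.zero_f]

end Disk

lemma quasiIso_g_of_acyclic_X₁ {A : Type u} [Category.{v} A] [Abelian A]
    {F : ShortComplex (ChainComplex A ℤ)} (hF : F.ShortExact) (h : F.X₁.Acyclic) :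
    QuasiIso F.g where
  quasiIsoAt n := by
    have hn : (ComplexShape.down ℤ).Rel n (n - 1) := sub_add_cancel n 1
    rw [quasiIsoAt_iff_isIso_homologyMap]
    have := (hF.homology_exact₂ n).mono_g ((h n).isZero_homology.eq_of_src _ _)
    have := (hF.homology_exact₃ n (n - 1) hn).epi_f ((h (n - 1)).isZero_homology.eq_of_tgt _ _)
    exact isIso_of_mono_of_epi (HomologicalComplex.homologyMap F.g n)

namespace BiadditiveTHC

section Balancing

variable {A₁ : Type u₁} {A₂ : Type u₂} {A₃ : Type u₃}
  [Category.{v₁} A₁] [Category.{v₂} A₂] [Category.{v₃} A₃]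
  [Abelian A₁] [Abelian A₂] [Abelian A₃]
  (S : BiadditiveTHC A₁ A₂ A₃) [HasColimits A₃]

lemma acyclic_tensor_of_homotopy_id_zero (C₁ : ChainComplex A₁ ℤ) {K : ChainComplex A₂ ℤ}
    (h : Homotopy (𝟙 K) 0) : (S.tensor C₁ K).Acyclic := by
  refine acyclic_of_homotopy_id_zero (((Homotopy.ofEq ?_).trans
    (HomologicalComplex.mapBifunctorMapHomotopy₂ (𝟙 C₁) h S.T (.down ℤ))).trans
    (Homotopy.ofEq ?_))
  · refine HomologicalComplex.hom_ext _ _ fun n => S.tensor_hom_ext fun p q hpq => ?_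
    rw [S.ι_tensorMap, HomologicalComplex.id_f, HomologicalComplex.id_f,
      CategoryTheory.Functor.map_id, Category.id_comp, Category.comp_id]
  · refine HomologicalComplex.hom_ext _ _ fun n => S.tensor_hom_ext fun p q hpq => ?_
    rw [S.ι_tensorMap, HomologicalComplex.zero_f, HomologicalComplex.zero_f, Functor.map_zero,
      zero_comp, comp_zero]

variable [CountableAB4 A₃] {C₁ : ChainComplex A₁ ℤ} (hC : ∀ p, S.flat₁ (C₁.X p))

include hC

lemma shortExact_tensorShortComplex_of_flat₁ {F : ShortComplex (ChainComplex A₂ ℤ)}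
    (hF : F.ShortExact) : (S.tensorShortComplex C₁ F).ShortExact :=
  S.shortExact_tensorShortComplex C₁ hF fun p q =>
    have := hF.mono_f
    hC p (F.f.f q)

variable (hC₀ : ∀ p < 0, IsZero (C₁.X p))

include hC₀

/-- Induction on `n - m`: replacing `K` by the kernel of `toDisk K m`, which vanishes in one more
degree, does not change the homology of `T(C₁, K)`. -/
lemma acyclic_tensor {K : ChainComplex A₂ ℤ} (hK : K.Acyclic) (m : ℤ)
    (hm : ∀ q < m, IsZero (K.X q)) : (S.tensor C₁ K).Acyclic := fun n => by
  obtain ⟨k, hk⟩ : ∃ k : ℕ, n < m + k := ⟨(n - m + 1).toNat, by lia⟩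
  induction k generalizing K m with
  | zero =>
    refine HomologicalComplex.ExactAt.of_isZero (S.isZero_tensor_X fun p q h => ?_)
    by_cases hp : p < 0
    · exact .inl (hC₀ p hp)
    · exact .inr (hm q (by lia))
  | succ k ih =>
    let F := ShortComplex.mk _ _ (kernel.condition (toDisk K m))
    have : Epi (toDisk K m) :=
      have := epi_toDisk_f hK hm
      HomologicalComplex.epi_of_epi_f _ this
    have hF : F.ShortExact := { exact := ShortComplex.exact_kernel _ }
    have hL : F.X₁.Acyclic :=
      hF.acyclic_X₁ ⟨fun i => (quasiIsoAt_iff_exactAt _ i (hK i)).2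
        (acyclic_of_homotopy_id_zero (diskHomotopy _ _) i)⟩
    have hL₀ := isZero_kernel_toDisk_X hm
    exact (S.shortExact_tensorShortComplex_of_flat₁ hC hF).exactAt_X₂ n
      (ih hL (m + 1) (fun q hq => hL₀ q (by lia)) (by lia))
      (S.acyclic_tensor_of_homotopy_id_zero C₁ (diskHomotopy _ _) n)

lemma quasiIso_tensorMap {K L : ChainComplex A₂ ℤ} (f : K ⟶ L) (hf : Epi f) (hf' : QuasiIso f)
    (m : ℤ) (hm : ∀ q < m, IsZero (K.X q)) : QuasiIso (S.tensorMap C₁ f) := by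
  let F := ShortComplex.mk _ _ (kernel.condition f)
  have hF : F.ShortExact := { exact := ShortComplex.exact_kernel _ }
  have hF₁ : (S.tensor C₁ F.X₁).Acyclic :=
    S.acyclic_tensor hC hC₀ (hF.acyclic_X₁ hf') m fun q hq =>
      have := (hF.map_of_exact (HomologicalComplex.eval A₂ _ q)).mono_f
      (hm q hq).of_mono (F.f.f q)
  exact quasiIso_g_of_acyclic_X₁ (S.shortExact_tensorShortComplex_of_flat₁ hC hF) hF₁

end Balancing

end BiadditiveTHC

section RightExact

variable {A : Type u} [Category.{v} A] [Abelian A] {P : ShortComplex A} {M : A} {ε : P.X₃ ⟶ M}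

lemma comp_kernel_lift (w : P.g ≫ ε = 0) : P.f ≫ kernel.lift ε P.g w = 0 := by
  rw [← cancel_mono (kernel.ι ε), Category.assoc, kernel.lift_ι, zero_comp, P.zero]

lemma exact_comp_kernel_lift (hP : P.Exact) (w : P.g ≫ ε = 0) :
    (ShortComplex.mk _ _ (comp_kernel_lift w)).Exact := by
  let φ : ShortComplex.mk _ _ (comp_kernel_lift w) ⟶ P :=
    { τ₁ := 𝟙 _, τ₂ := 𝟙 _, τ₃ := kernel.ι ε }
  have : Epi φ.τ₁ := inferInstanceAs (Epi (𝟙 _))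
  have : IsIso φ.τ₂ := inferInstanceAs (IsIso (𝟙 _))
  have : Mono φ.τ₃ := inferInstanceAs (Mono (kernel.ι ε))
  exact (ShortComplex.exact_iff_of_epi_of_isIso_of_mono φ).2 hP

/-- The right homology data with opcycles `Q`, a cokernel of `P.f`, obtained from a factorization
of `P.g` through `Q`. -/
def rightHomologyDataOfFac {Q : A} {p : P.X₂ ⟶ Q} (k : Q ⟶ P.X₃) (fac : p ≫ k = P.g)
    (wp : P.f ≫ p = 0) (hp : IsColimit (CokernelCofork.ofπ p wp)) : P.RightHomologyData :=
  have hk : hp.desc (CokernelCofork.ofπ P.g P.zero) = k :=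
    Cofork.IsColimit.hom_ext hp ((hp.fac _ WalkingParallelPair.one).trans fac.symm)
  have wι : kernel.ι k ≫ hp.desc (CokernelCofork.ofπ P.g P.zero) = 0 :=
    (congrArg (kernel.ι k ≫ ·) hk).trans (kernel.condition k)
  { Q, H := kernel k, p, ι := kernel.ι k, wp, hp, wι
    hι := by
      subst hk
      exact kernelIsKernel _ }

/-- If `P₁ ⟶ P₂ ⟶ P₃ ⟶ M` is exact and `G` is right exact, then the opcycles of `G(P)` are
`G(ker ε)`, hence the homology of `G(P)` is the kernel of `G(ker ε) ⟶ G(P₃)`. -/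
def homologyMapIsoKernel {B : Type u₁} [Category.{v₁} B] [Abelian B] (G : A ⥤ B) [G.Additive]
    [PreservesFiniteColimits G] (hP : P.Exact) {w : P.g ≫ ε = 0}
    (hε : (ShortComplex.mk _ _ w).Exact) :
    (P.map G).homology ≅ kernel (G.map (kernel.ι ε)) :=
  have : Epi (kernel.lift ε P.g w) := (ShortComplex.exact_iff_epi_kernel_lift _).1 hε
  have hQ := (exact_comp_kernel_lift hP w).map_of_epi_of_preservesCokernel G this inferInstance
  have : Epi ((ShortComplex.mk _ _ (comp_kernel_lift w)).map G).g :=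
    inferInstanceAs (Epi (G.map (kernel.lift ε P.g w)))
  (rightHomologyDataOfFac (P := P.map G) (G.map (kernel.ι ε))
    ((G.map_comp _ _).symm.trans (congrArg G.map (kernel.lift_ι _ _ w))) _
    hQ.gIsCokernel).homologyIso

end RightExact

namespace CompleteResolution

variable {A : Type u} [Category.{v} A] [Abelian A] {K : ObjectProperty A} {M : A}
  (R : CompleteResolution K M)

lemma exact_augmentation_and_epi :
    (ShortComplex.mk _ _ (d_augmentation R.π)).Exact ∧ Epi (augmentation R.π) :=
  have := R.quasiIso
  (quasiIsoAt_zero_iff R.π (R.isZero _ (by simp))).1 inferInstance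

lemma epi_π : Epi R.π := by
  refine HomologicalComplex.epi_of_epi_f _ fun n => ?_
  by_cases hn : n = 0
  · subst hn
    exact ((MorphismProperty.epimorphisms A).cancel_right_of_respectsIso _ _).1
      R.exact_augmentation_and_epi.2
  · exact ⟨fun _ _ _ => (HomologicalComplex.isZero_single_obj_X _ _ _ _ hn).eq_of_src _ _⟩

lemma exact_d_d : (R.complex.sc' 2 1 0).Exact :=
  have := R.quasiIso
  (R.complex.exactAt_iff' 2 1 0 (by simp) (by simp)).1 ((exactAt_iff_of_quasiIsoAt R.π 1).2
    (HomologicalComplex.exactAt_single_obj _ _ _ _ (by simp)))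

end CompleteResolution

namespace BiadditiveTHC

section TorOne

variable {A₁ : Type u₁} {A₂ : Type u₂} {A₃ : Type u₃}
  [Category.{v₁} A₁] [Category.{v₂} A₂] [Category.{v₃} A₃]
  [Abelian A₁] [Abelian A₂] [Abelian A₃]
  (S : BiadditiveTHC A₁ A₂ A₃) [HasColimits A₃]

section Single

variable (C₁ : ChainComplex A₁ ℤ) {K : ChainComplex A₂ ℤ} (hK : ∀ q ≠ 0, IsZero (K.X q))

include hK

lemma isIso_ι (n : ℤ) : IsIso (S.ι C₁ K n 0 n (add_zero n)) := by
  have : Mono (S.ι C₁ K n 0 n (add_zero n)) :=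
    MonoCoprod.mono_inj (fun x : Bidegree n => (S.T.obj (C₁.X x.1.1)).obj (K.X x.1.2)) _
      (S.isColimitTensor C₁ K n) ⟨(n, 0), add_zero n⟩
  have : Epi (S.ι C₁ K n 0 n (add_zero n)) :=
    ⟨fun a b hab => S.tensor_hom_ext fun p q h => by
      by_cases hq : q = 0
      · subst hq
        obtain rfl : p = n := by lia
        exact hab
      · exact ((S.T.obj (C₁.X p)).map_isZero (hK q hq)).eq_of_src _ _⟩
  exact isIso_of_mono_of_epi _

/-- Tensoring with a complex concentrated in degree `0`. -/
def tensorIsoMap :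
    ((S.T.flip.obj (K.X 0)).mapHomologicalComplex (ComplexShape.down ℤ)).obj C₁ ≅
      S.tensor C₁ K :=
  have (n : ℤ) : IsIso (S.ι C₁ K n 0 n (add_zero n)) := S.isIso_ι C₁ hK n
  HomologicalComplex.Hom.isoOfComponents (fun n => (asIso (S.ι C₁ K n 0 n (add_zero n)) :))
    fun n m hm => by
      refine (S.ι_d C₁ K n 0 n m (-1) m (add_zero n) hm rfl hm).trans ?_
      rw [(hK (-1) (by simp)).eq_of_tgt (K.d 0 (-1)) 0, CategoryTheory.Functor.map_zero,
        zero_comp, smul_zero, add_zero]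
      rfl

end Single

/-- `Tor₁` is computed by resolving the first variable only; the snake lemma then moves the
computation to the second variable. -/
lemma nonempty_tor_one_iso [CountableAB4 A₃] {X₁ : A₁} {F : ShortComplex A₂} (hF : F.ShortExact)
    (hF₂ : S.flat₂ F.X₂) (R₁ : CompleteResolution S.flat₁ X₁)
    (R₂ : CompleteResolution S.flat₂ F.X₃) :
    Nonempty (S.tor R₁ R₂ 1 ≅ kernel ((S.T.obj X₁).map F.f)) := by
  let K := (HomologicalComplex.single A₂ (ComplexShape.down ℤ) 0).obj F.X₃
  let j := kernel.ι (augmentation R₁.π)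
  obtain ⟨hε, _⟩ := R₁.exact_augmentation_and_epi
  have := R₂.quasiIso
  have := S.quasiIso_tensorMap R₁.mem R₁.isZero R₂.π R₂.epi_π R₂.quasiIso 0 R₂.isZero
  let e₁ : S.tor R₁ R₂ 1 ≅ (S.tensor R₁.complex K).homology 1 :=
    isoOfQuasiIsoAt (S.tensorMap R₁.complex R₂.π) 1
  let G := S.T.flip.obj (K.X 0)
  let GR := (G.mapHomologicalComplex (ComplexShape.down ℤ)).obj R₁.complex
  let e₂ : (S.tensor R₁.complex K).homology 1 ≅ GR.homology 1 :=
    (HomologicalComplex.homologyFunctor A₃ _ 1).mapIso (S.tensorIsoMap R₁.complex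
      fun q hq => HomologicalComplex.isZero_single_obj_X _ _ _ _ hq).symm
  let e₃ : GR.homology 1 ≅ kernel ((S.T.map j).app (K.X 0)) :=
    ShortComplex.homologyMapIso (GR.isoSc' 2 1 0 (by simp) (by simp)) ≪≫
      homologyMapIsoKernel G R₁.exact_d_d hε
  let e₄ : kernel ((S.T.map j).app (K.X 0)) ≅ kernel ((S.T.map j).app F.X₃) :=
    kernel.mapIso _ _ ((S.T.obj _).mapIso (HomologicalComplex.singleObjXSelf _ 0 F.X₃))
      ((S.T.obj _).mapIso (HomologicalComplex.singleObjXSelf _ 0 F.X₃))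
      ((S.T.map j).naturality _).symm
  have hE : (ShortComplex.mk j _ (kernel.condition _)).ShortExact :=
    { exact := ShortComplex.exact_kernel _ }
  exact (S.nonempty_kernel_iso hE (R₁.mem 0) hF hF₂).map (e₁ ≪≫ e₂ ≪≫ e₃ ≪≫ e₄ ≪≫ ·)

end TorOne

end BiadditiveTHC

namespace BiadditiveTHC

section ZeroDifferential

variable {A₁ : Type u₁} {A₂ : Type u₂} {A₃ : Type u₃}
  [Category.{v₁} A₁] [Category.{v₂} A₂] [Category.{v₃} A₃]
  [Abelian A₁] [Abelian A₂] [Abelian A₃]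
  (S : BiadditiveTHC A₁ A₂ A₃) [HasColimits A₃] (C₁ : ChainComplex A₁ ℤ) (G : ℤ → A₂)

/-- `T(C₁, G)`, for a family `G` regarded as a complex with zero differential. -/
abbrev tensorZero : ChainComplex A₃ ℤ := S.tensor C₁ (zeroComplex G)

/-- The inclusion of the summand `T((C₁)_p, G_q)` of `T(C₁, G)`. -/
def ι₀ (p q n : ℤ) (h : p + q = n) :
    (S.T.obj (C₁.X p)).obj (G q) ⟶ (S.tensorZero C₁ G).X n :=
  S.ι C₁ (zeroComplex G) p q n h

/-- The degree `n + a` term of `T(C₁, G)` as a coproduct over the bidegrees of total degree `n`. -/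
def isColimitι₀ (n a : ℤ) :
    IsColimit (Cofan.mk ((S.tensorZero C₁ G).X (n + a)) fun x : Bidegree n =>
      S.ι₀ C₁ G (x.1.1 + a) x.1.2 (n + a) (by lia)) :=
  let e : Bidegree n ≃ Bidegree (n + a) :=
    { toFun x := ⟨(x.1.1 + a, x.1.2), by lia⟩
      invFun x := ⟨(x.1.1 - a, x.1.2), by lia⟩
      left_inv x := by simp
      right_inv x := by simp }
  Cofan.isColimitEquivOfEquiv e _ (S.isColimitTensor C₁ (zeroComplex G) (n + a))

lemma ι₀_d (p q n p' n' : ℤ) (h : p + q = n) (hp : p' + 1 = p) (hn : n' + 1 = n) :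
    S.ι₀ C₁ G p q n h ≫ (S.tensorZero C₁ G).d n n' =
      (S.T.map (C₁.d p p')).app (G q) ≫ S.ι₀ C₁ G p' q n' (by lia) := by
  have h₀ : (S.T.obj (C₁.X p)).map ((zeroComplex G).d q (q - 1)) = 0 := Functor.map_zero _ _ _
  have e := S.ι_d C₁ (zeroComplex G) p q n p' (q - 1) n' h hp (by lia) hn
  rw [h₀, zero_comp, smul_zero, add_zero] at e
  exact e

/-- The morphism `T(Z_p(C₁), G_q) ⟶ Z_n(T(C₁, G))`. -/
def cyclesι (p q n : ℤ) (h : p + q = n) :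
    (S.T.obj (C₁.cycles p)).obj (G q) ⟶ (S.tensorZero C₁ G).cycles n :=
  (S.tensorZero C₁ G).liftCycles
    ((S.T.map (C₁.iCycles p)).app (G q) ≫ S.ι₀ C₁ G p q n h) (n - 1) (by simp) (by
      rw [Category.assoc, S.ι₀_d C₁ G p q n (p - 1) (n - 1) h (by lia) (by lia),
        reassoc_of% (S.map_comp_map_app (C₁.iCycles_d p (p - 1)) (G q)), zero_comp])

lemma cyclesι_iCycles (p q n : ℤ) (h : p + q = n) :
    S.cyclesι C₁ G p q n h ≫ (S.tensorZero C₁ G).iCycles n =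
      (S.T.map (C₁.iCycles p)).app (G q) ≫ S.ι₀ C₁ G p q n h :=
  HomologicalComplex.liftCycles_i _ _ _ _ _

lemma ι₀_toCycles (p q n p' n' : ℤ) (h : p + q = n) (hp : p' + 1 = p) (hn : n' + 1 = n) :
    S.ι₀ C₁ G p q n h ≫ (S.tensorZero C₁ G).toCycles n n' =
      (S.T.map (C₁.toCycles p p')).app (G q) ≫ S.cyclesι C₁ G p' q n' (by lia) := by
  rw [← cancel_mono ((S.tensorZero C₁ G).iCycles n'), Category.assoc,
    HomologicalComplex.toCycles_i, S.ι₀_d C₁ G p q n p' n' h hp hn, Category.assoc,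
    cyclesι_iCycles, ← NatTrans.comp_app_assoc, ← Functor.map_comp, HomologicalComplex.toCycles_i]

/-- The morphism `T(H_p(C₁), G_q) ⟶ H_n(T(C₁, G))`. -/
def homologyι (p q n : ℤ) (h : p + q = n) :
    (S.T.obj (C₁.homology p)).obj (G q) ⟶ (S.tensorZero C₁ G).homology n :=
  descHomology (S.T.flip.obj (G q)) C₁ p
    (S.cyclesι C₁ G p q n h ≫ (S.tensorZero C₁ G).homologyπ n) (by
      change (S.T.map (C₁.toCycles (p + 1) p)).app (G q) ≫ _ = 0
      rw [← reassoc_of% (S.ι₀_toCycles C₁ G (p + 1) q (n + 1) p n (by lia) rfl rfl),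
        HomologicalComplex.toCycles_comp_homologyπ, comp_zero])

lemma π_homologyι (p q n : ℤ) (h : p + q = n) :
    (S.T.map (C₁.homologyπ p)).app (G q) ≫ S.homologyι C₁ G p q n h =
      S.cyclesι C₁ G p q n h ≫ (S.tensorZero C₁ G).homologyπ n :=
  π_descHomology (S.T.flip.obj (G q)) C₁ p _ _

variable {G} in
/-- Cycles commute with `T(-, G)` if the `G_q` are flat. -/
def isColimitCyclesι [CountableAB4 A₃] (hG : ∀ q, S.flat₂ (G q)) (n : ℤ) :
    IsColimit (Cofan.mk ((S.tensorZero C₁ G).cycles n) fun x : Bidegree n =>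
      S.cyclesι C₁ G x.1.1 x.1.2 n x.2) := by
  let D := S.tensorZero C₁ G
  let X : ShortComplex A₃ := .mk (D.iCycles n) (D.d n (n + -1)) (D.iCycles_d _ _)
  let Z (p : ℤ) : ShortComplex A₁ := .mk (C₁.iCycles p) (C₁.d p (p + -1)) (C₁.iCycles_d _ _)
  have hX : X.Exact := X.exact_of_f_is_kernel (D.cyclesIsKernel n (n + -1) (by simp; rfl))
  have hZ (p : ℤ) : (Z p).Exact :=
    (Z p).exact_of_f_is_kernel (C₁.cyclesIsKernel p (p + -1) (by simp; rfl))
  let φ (x : Bidegree n) : (Z x.1.1).map (S.T.flip.obj (G x.1.2)) ⟶ X :=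
    { τ₁ := S.cyclesι C₁ G x.1.1 x.1.2 n x.2
      τ₂ := S.ι₀ C₁ G x.1.1 x.1.2 n x.2
      τ₃ := S.ι₀ C₁ G (x.1.1 + -1) x.1.2 (n + -1) (by lia)
      comm₁₂ := S.cyclesι_iCycles C₁ G x.1.1 x.1.2 n x.2
      comm₂₃ := S.ι₀_d C₁ G x.1.1 x.1.2 n (x.1.1 + -1) (n + -1) x.2 (by lia) (by lia) }
  have hφ (x : Bidegree n) : ((Z x.1.1).map (S.T.flip.obj (G x.1.2))).Exact := by
    have := (hG x.1.2).preservesHomology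
    exact (hZ x.1.1).map (S.T.flip.obj (G x.1.2))
  exact isColimitCofanτ₁ φ hφ (fun x => hG x.1.2 (C₁.iCycles x.1.1)) hX
    (inferInstanceAs (Mono (D.iCycles n))) (S.isColimitTensor C₁ (zeroComplex G) n)
    (S.isColimitι₀ C₁ G n (-1))

variable {G} in
/-- Homology commutes with `T(-, G)` if the `G_q` are flat. -/
def isColimitHomologyι [CountableAB4 A₃] (hG : ∀ q, S.flat₂ (G q)) (n : ℤ) :
    IsColimit (Cofan.mk ((S.tensorZero C₁ G).homology n) fun x : Bidegree n =>
      S.homologyι C₁ G x.1.1 x.1.2 n x.2) := by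
  let D := S.tensorZero C₁ G
  let X : ShortComplex A₃ :=
    .mk (D.toCycles (n + 1) n) (D.homologyπ n) (D.toCycles_comp_homologyπ _ _)
  let H (p : ℤ) : ShortComplex A₁ :=
    .mk (C₁.toCycles (p + 1) p) (C₁.homologyπ p) (C₁.toCycles_comp_homologyπ _ _)
  have hX : X.Exact := X.exact_of_g_is_cokernel (D.homologyIsCokernel (n + 1) n (by simp))
  let φ (x : Bidegree n) : (H x.1.1).map (S.T.flip.obj (G x.1.2)) ⟶ X :=
    { τ₁ := S.ι₀ C₁ G (x.1.1 + 1) x.1.2 (n + 1) (by lia)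
      τ₂ := S.cyclesι C₁ G x.1.1 x.1.2 n x.2
      τ₃ := S.homologyι C₁ G x.1.1 x.1.2 n x.2
      comm₁₂ := S.ι₀_toCycles C₁ G (x.1.1 + 1) x.1.2 (n + 1) x.1.1 n (by lia) rfl rfl
      comm₂₃ := (S.π_homologyι C₁ G x.1.1 x.1.2 n x.2).symm }
  exact isColimitCofanτ₃ φ (fun x => S.epi_map_app (C₁.homologyπ x.1.1) (G x.1.2)) hX
    (inferInstanceAs (Epi (D.homologyπ n))) (S.isColimitι₀ C₁ G n 1)
    (S.isColimitCyclesι C₁ hG n)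

end ZeroDifferential

end BiadditiveTHC

section CyclesAndBoundaries

variable {A : Type u} [Category.{v} A] [Abelian A] (C : ChainComplex A ℤ) (q : ℤ)

/-- The boundaries of `C` in degree `q - 1`. With this indexing, `d` induces an epimorphism of
complexes from `C` to its boundaries with zero differential. -/
abbrev shiftedBoundaries : A := Limits.image (C.d q (q - 1))

/-- The epimorphism from `C_q` to the boundaries in degree `q - 1`. -/
def toBoundaries : C.X q ⟶ shiftedBoundaries C q := factorThruImage (C.d q (q - 1))

instance : Epi (toBoundaries C q) := inferInstanceAs (Epi (factorThruImage (C.d q (q - 1))))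

lemma toBoundaries_imageι : toBoundaries C q ≫ Limits.image.ι (C.d q (q - 1)) = C.d q (q - 1) :=
  Limits.image.fac _

/-- The inclusion of the boundaries in degree `q - 1` into the cycles. -/
def boundariesToCycles : shiftedBoundaries C q ⟶ C.cycles (q - 1) :=
  C.liftCycles (Limits.image.ι (C.d q (q - 1))) (q - 1 - 1) (by simp) (by
    rw [← cancel_epi (toBoundaries C q), reassoc_of% toBoundaries_imageι C q, C.d_comp_d,
      comp_zero])

lemma boundariesToCycles_iCycles :
    boundariesToCycles C q ≫ C.iCycles (q - 1) = Limits.image.ι (C.d q (q - 1)) :=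
  C.liftCycles_i _ _ _ _

instance : Mono (boundariesToCycles C q) := mono_of_mono_fac (boundariesToCycles_iCycles C q)

lemma toBoundaries_boundariesToCycles :
    toBoundaries C q ≫ boundariesToCycles C q = C.toCycles q (q - 1) := by
  rw [← cancel_mono (C.iCycles (q - 1)), Category.assoc, boundariesToCycles_iCycles,
    toBoundaries_imageι, C.toCycles_i]

lemma d_toBoundaries (p : ℤ) : C.d p q ≫ toBoundaries C q = 0 := by
  rw [← cancel_mono (Limits.image.ι (C.d q (q - 1))), Category.assoc, toBoundaries_imageι,
    C.d_comp_d, zero_comp]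

/-- The inclusion into `C` of its cycles with zero differential. -/
def cyclesInclusion : zeroComplex (fun q => C.cycles q) ⟶ C where
  f q := C.iCycles q
  comm' q q' _ := (C.iCycles_d q q').trans zero_comp.symm

/-- The projection of `C` onto its shifted boundaries with zero differential. -/
def boundariesProjection : C ⟶ zeroComplex (shiftedBoundaries C) where
  f q := toBoundaries C q
  comm' q q' _ := comp_zero.trans (d_toBoundaries C q' q).symm

lemma iCycles_toBoundaries : C.iCycles q ≫ toBoundaries C q = 0 := by
  rw [← cancel_mono (Limits.image.ι (C.d q (q - 1))), Category.assoc, toBoundaries_imageι,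
    C.iCycles_d, zero_comp]

/-- The short complex `Z(C) ⟶ C ⟶ B(C)`. -/
abbrev cyclesBoundaries : ShortComplex (ChainComplex A ℤ) :=
  .mk (cyclesInclusion C) (boundariesProjection C) (by ext q; exact iCycles_toBoundaries C q)

lemma shortExact_cyclesBoundaries : (cyclesBoundaries C).ShortExact :=
  HomologicalComplex.shortExact_of_degreewise_shortExact _ fun q =>
    { exact := ShortComplex.exact_of_f_is_kernel _ (isKernelOfComp (Limits.image.ι _) _
        (C.cyclesIsKernel q (q - 1) (by simp)) (iCycles_toBoundaries C q)
        (toBoundaries_imageι C q))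
      mono_f := inferInstanceAs (Mono (C.iCycles q))
      epi_g := inferInstanceAs (Epi (toBoundaries C q)) }

lemma boundariesToCycles_homologyπ : boundariesToCycles C q ≫ C.homologyπ (q - 1) = 0 := by
  rw [← cancel_epi (toBoundaries C q), comp_zero,
    reassoc_of% toBoundaries_boundariesToCycles C q, C.toCycles_comp_homologyπ]

/-- The short complex `B_{q-1}(C) ⟶ Z_{q-1}(C) ⟶ H_{q-1}(C)`. -/
abbrev boundariesCyclesHomology : ShortComplex A :=
  .mk (boundariesToCycles C q) (C.homologyπ (q - 1)) (boundariesToCycles_homologyπ C q)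

lemma shortExact_boundariesCyclesHomology : (boundariesCyclesHomology C q).ShortExact where
  exact := ShortComplex.exact_of_g_is_cokernel _ (isCokernelOfComp (toBoundaries C q) _
    (C.homologyIsCokernel q (q - 1) (by simp)) (boundariesToCycles_homologyπ C q)
    (toBoundaries_boundariesToCycles C q))
  mono_f := inferInstanceAs (Mono (boundariesToCycles C q))
  epi_g := inferInstanceAs (Epi (C.homologyπ (q - 1)))

lemma homologyπ_δ_eq {ι : Type*} {c : ComplexShape ι} {F : ShortComplex (HomologicalComplex A c)}
    (hF : F.ShortExact) {i j : ι} (hij : c.Rel i j) {W : A} (z₃ : W ⟶ F.X₃.cycles i)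
    (x₂ : W ⟶ F.X₂.X i) (z₁ : W ⟶ F.X₁.cycles j)
    (hg : x₂ ≫ F.g.f i = z₃ ≫ F.X₃.iCycles i)
    (hd : x₂ ≫ F.X₂.d i j = (z₁ ≫ F.X₁.iCycles j) ≫ F.f.f j) :
    z₃ ≫ F.X₃.homologyπ i ≫ hF.δ i j hij = z₁ ≫ F.X₁.homologyπ j := by
  have h₃ := F.X₃.liftCycles_i (z₃ ≫ F.X₃.iCycles i) j (c.next_eq' hij) (by simp)
  have h₁ := F.X₁.liftCycles_i (z₁ ≫ F.X₁.iCycles j) _ rfl (by simp)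
  rw [cancel_mono] at h₃ h₁
  simpa only [h₃, h₁] using hF.δ_eq i j hij _ (by simp) x₂ hg _ hd.symm _ rfl

end CyclesAndBoundaries

namespace BiadditiveTHC

section Connecting

variable {A₁ : Type u₁} {A₂ : Type u₂} {A₃ : Type u₃}
  [Category.{v₁} A₁] [Category.{v₂} A₂] [Category.{v₃} A₃]
  [Abelian A₁] [Abelian A₂] [Abelian A₃]
  (S : BiadditiveTHC A₁ A₂ A₃)

lemma flat₂_shiftedBoundaries {C : ChainComplex A₂ ℤ} (hB : ∀ n : ℤ, S.flat₂ (boundaries C n))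
    (q : ℤ) : S.flat₂ (shiftedBoundaries C q) := by
  obtain ⟨n, rfl⟩ : ∃ n, n + 1 = q := ⟨q - 1, by lia⟩
  have h (m : ℤ) (hm : m = n) : S.flat₂ (Limits.image (C.d (n + 1) m)) := by
    subst hm
    exact hB m
  exact h _ (by lia)

variable [HasColimits A₃] (C₁ : ChainComplex A₁ ℤ) (C₂ : ChainComplex A₂ ℤ)

lemma cyclesι_cyclesMap (p q n : ℤ) (h : p + q = n) :
    S.cyclesι C₁ (fun q => C₂.cycles q) p q n h ≫
      HomologicalComplex.cyclesMap (S.tensorMap C₁ (cyclesInclusion C₂)) n =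
      S.cyclesMap C₁ C₂ p q n h := by
  rw [← cancel_mono ((S.tensor C₁ C₂).iCycles n), cyclesMap_i, Category.assoc,
    HomologicalComplex.cyclesMap_i,
    reassoc_of% (S.cyclesι_iCycles C₁ (fun q => C₂.cycles q) p q n h)]
  exact congrArg (_ ≫ ·) (S.ι_tensorMap C₁ (cyclesInclusion C₂) p q n h)

lemma homologyι_homologyMap (p q n : ℤ) (h : p + q = n) :
    S.homologyι C₁ (fun q => C₂.cycles q) p q n h ≫
      HomologicalComplex.homologyMap (S.tensorMap C₁ (cyclesInclusion C₂)) n =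
      (S.T.obj (C₁.homology p)).map (C₂.homologyπ q) ≫ S.γComponent C₁ C₂ p q n h := by
  rw [← cancel_epi ((S.T.map (C₁.homologyπ p)).app (C₂.cycles q)), π_γComponent,
    reassoc_of% (S.π_homologyι C₁ (fun q => C₂.cycles q) p q n h),
    HomologicalComplex.homologyπ_naturality, ← Category.assoc, cyclesι_cyclesMap]

lemma map_iCycles_ι_tensorMap (p q n : ℤ) (h : p + q = n) :
    ((S.T.map (C₁.iCycles p)).app (C₂.X q) ≫ S.ι C₁ C₂ p q n h) ≫
        (S.tensorMap C₁ (boundariesProjection C₂)).f n =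
      ((S.T.obj (C₁.cycles p)).map (toBoundaries C₂ q) ≫
        S.cyclesι C₁ (shiftedBoundaries C₂) p q n h) ≫
          (S.tensorZero C₁ (shiftedBoundaries C₂)).iCycles n := by
  rw [Category.assoc, Category.assoc, cyclesι_iCycles, NatTrans.naturality_assoc]
  exact congrArg (_ ≫ ·) (S.ι_tensorMap C₁ (boundariesProjection C₂) p q n h)

lemma map_iCycles_ι_d (p q n m : ℤ) (h : p + q = n) (hm : m + 1 = n) :
    ((S.T.map (C₁.iCycles p)).app (C₂.X q) ≫ S.ι C₁ C₂ p q n h) ≫ (S.tensor C₁ C₂).d n m =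
      ((Int.negOnePow p • (S.T.obj (C₁.cycles p)).map (C₂.toCycles q (q - 1)) ≫
        S.cyclesι C₁ (fun q => C₂.cycles q) p (q - 1) m (by lia)) ≫
          (S.tensorZero C₁ fun q => C₂.cycles q).iCycles m) ≫
            (S.tensorMap C₁ (cyclesInclusion C₂)).f m := by
  have hι : S.ι₀ C₁ (fun q => C₂.cycles q) p (q - 1) m (by lia) ≫
      (S.tensorMap C₁ (cyclesInclusion C₂)).f m =
        (S.T.obj (C₁.X p)).map (C₂.iCycles (q - 1)) ≫ S.ι C₁ C₂ p (q - 1) m (by lia) :=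
    S.ι_tensorMap C₁ (cyclesInclusion C₂) p (q - 1) m (by lia)
  simp only [Category.assoc, Linear.units_smul_comp]
  rw [S.ι_d C₁ C₂ p q n (p - 1) (q - 1) m h (by lia) (by lia) hm, Preadditive.comp_add,
    reassoc_of% (S.map_comp_map_app (C₁.iCycles_d p (p - 1)) (C₂.X q)), zero_comp, zero_add,
    Linear.comp_units_smul, reassoc_of% S.cyclesι_iCycles, hι, NatTrans.naturality_assoc,
    ← Functor.map_comp_assoc, HomologicalComplex.toCycles_i]

variable {C₁ C₂} in
/-- The connecting morphism of `T(C₁, Z(C₂)) ⟶ T(C₁, C₂) ⟶ T(C₁, B(C₂))`. -/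
def δ (hS : (S.tensorShortComplex C₁ (cyclesBoundaries C₂)).ShortExact) (n m : ℤ)
    (hm : m + 1 = n) : (S.tensorZero C₁ (shiftedBoundaries C₂)).homology n ⟶
      (S.tensorZero C₁ fun q => C₂.cycles q).homology m :=
  hS.δ n m hm

variable {C₁ C₂} in
lemma homologyι_δ (hS : (S.tensorShortComplex C₁ (cyclesBoundaries C₂)).ShortExact)
    (p q n m : ℤ) (h : p + q = n) (hm : m + 1 = n) :
    S.homologyι C₁ (shiftedBoundaries C₂) p q n h ≫ S.δ hS n m hm =
      (Int.negOnePow p • (S.T.obj (C₁.homology p)).map (boundariesToCycles C₂ q)) ≫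
        S.homologyι C₁ (fun q => C₂.cycles q) p (q - 1) m (by lia) := by
  have key : ((S.T.obj (C₁.cycles p)).map (toBoundaries C₂ q) ≫
      S.cyclesι C₁ (shiftedBoundaries C₂) p q n h) ≫
        (S.tensorZero C₁ (shiftedBoundaries C₂)).homologyπ n ≫ S.δ hS n m hm =
      (Int.negOnePow p • (S.T.obj (C₁.cycles p)).map (C₂.toCycles q (q - 1)) ≫
        S.cyclesι C₁ (fun q => C₂.cycles q) p (q - 1) m (by lia)) ≫
          (S.tensorZero C₁ fun q => C₂.cycles q).homologyπ m :=
    homologyπ_δ_eq hS hm _ _ _ (S.map_iCycles_ι_tensorMap C₁ C₂ p q n h)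
      (S.map_iCycles_ι_d C₁ C₂ p q n m h hm)
  rw [← cancel_epi ((S.T.map (C₁.homologyπ p)).app (shiftedBoundaries C₂ q)),
    ← cancel_epi ((S.T.obj (C₁.cycles p)).map (toBoundaries C₂ q)),
    reassoc_of% S.π_homologyι C₁ (shiftedBoundaries C₂) p q n h, ← Category.assoc, key]
  simp only [Linear.units_smul_comp, Linear.comp_units_smul, Category.assoc]
  rw [← NatTrans.naturality_assoc,
    S.π_homologyι C₁ (fun q => C₂.cycles q) p (q - 1) m (by lia), ← Functor.map_comp_assoc,
    toBoundaries_boundariesToCycles]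

end Connecting

end BiadditiveTHC

section Exactness

variable {A : Type u} [Category.{v} A] [Abelian A]

lemma mono_of_exact_of_epi {U' U V W : A} {a : U' ⟶ U} {b : U ⟶ W} {π : U ⟶ V} {γ : V ⟶ W}
    {w : a ≫ b = 0} (h : (ShortComplex.mk a b w).Exact) (haπ : a ≫ π = 0) [Epi π]
    (hγ : π ≫ γ = b) : Mono γ := by
  refine Preadditive.mono_of_cancel_zero _ fun {B} x hx => ?_
  obtain ⟨B', p, _, y, hy⟩ := surjective_up_to_refinements_of_epi π x
  have hyb : y ≫ b = 0 := by rw [← hγ, ← reassoc_of% hy, hx, comp_zero]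
  obtain ⟨B'', p', _, z, hz⟩ := h.exact_up_to_refinements y hyb
  rw [← cancel_epi p, ← cancel_epi p', hy, reassoc_of% hz, haπ, comp_zero, comp_zero, comp_zero]

lemma epi_of_exact_of_mono {N W X Y : A} {c : W ⟶ X} {d : X ⟶ Y} {β : W ⟶ N} {κ : N ⟶ X}
    {w : c ≫ d = 0} (h : (ShortComplex.mk c d w).Exact) (hκd : κ ≫ d = 0) [Mono κ]
    (hβ : β ≫ κ = c) : Epi β := by
  refine (epi_iff_surjective_up_to_refinements β).2 fun B y => ?_
  have hyd : (y ≫ κ) ≫ d = 0 := by rw [Category.assoc, hκd, comp_zero]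
  obtain ⟨B', p, hp, x, hx⟩ := h.exact_up_to_refinements (y ≫ κ) hyd
  exact ⟨B', p, hp, x, by rw [← cancel_mono κ, Category.assoc, Category.assoc, hβ]; exact hx⟩

lemma exists_shortExact_of_exact {U' U V W X Y N : A} {a : U' ⟶ U} {b : U ⟶ W} {c : W ⟶ X}
    {d : X ⟶ Y} {π : U ⟶ V} {γ : V ⟶ W} {κ : N ⟶ X} {wab : a ≫ b = 0} {wbc : b ≫ c = 0}
    {wcd : c ≫ d = 0} {wκd : κ ≫ d = 0}
    (hab : (ShortComplex.mk a b wab).Exact) (hbc : (ShortComplex.mk b c wbc).Exact)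
    (hcd : (ShortComplex.mk c d wcd).Exact) (haπ : a ≫ π = 0) (hπ : Epi π) (hγ : π ≫ γ = b)
    (hκd : (ShortComplex.mk κ d wκd).Exact) (hκ : Mono κ) :
    ∃ (β : W ⟶ N) (w : γ ≫ β = 0), (ShortComplex.mk γ β w).ShortExact := by
  obtain ⟨β, hβ⟩ : ∃ β, β ≫ κ = c := ⟨hκd.lift c wcd, hκd.lift_f c wcd⟩
  have wbβ : b ≫ β = 0 := by rw [← cancel_mono κ, Category.assoc, hβ, wbc, zero_comp]
  have wγβ : γ ≫ β = 0 := by rw [← cancel_epi π, reassoc_of% hγ, wbβ, comp_zero]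
  let toC : ShortComplex.mk b β wbβ ⟶ ShortComplex.mk b c wbc :=
    { τ₁ := 𝟙 U, τ₂ := 𝟙 W, τ₃ := κ, comm₁₂ := by simp, comm₂₃ := by simp [hβ] }
  let toΓ : ShortComplex.mk b β wbβ ⟶ ShortComplex.mk γ β wγβ :=
    { τ₁ := π, τ₂ := 𝟙 W, τ₃ := 𝟙 N, comm₁₂ := by simp [hγ], comm₂₃ := by simp }
  have hbβ : (ShortComplex.mk b β wbβ).Exact :=
    (ShortComplex.exact_iff_of_epi_of_isIso_of_mono toC).2 hbc
  exact ⟨β, wγβ,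
    { exact := (ShortComplex.exact_iff_of_epi_of_isIso_of_mono toΓ).1 hbβ
      mono_f := mono_of_exact_of_epi hab haπ hγ
      epi_g := epi_of_exact_of_mono hcd wκd hβ }⟩

lemma exact_units_smul_right {X Y Z : A} {f : X ⟶ Y} {g : Y ⟶ Z} {w : f ≫ g = 0}
    (h : (ShortComplex.mk f g w).Exact) (s : ℤˣ) :
    (ShortComplex.mk f (s • g) (by rw [Linear.comp_units_smul, w, smul_zero])).Exact := by
  rw [ShortComplex.exact_iff_exact_up_to_refinements] at h ⊢
  intro B x (hx : x ≫ (s • g) = 0)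
  refine h x ?_
  rwa [Linear.comp_units_smul, smul_eq_zero_iff_eq] at hx

end Exactness

namespace BiadditiveTHC

section Kunneth

variable {A₁ : Type u₁} {A₂ : Type u₂} {A₃ : Type u₃}
  [Category.{v₁} A₁] [Category.{v₂} A₂] [Category.{v₃} A₃]
  [Abelian A₁] [Abelian A₂] [Abelian A₃]
  (S : BiadditiveTHC A₁ A₂ A₃)

lemma shortExact_tensor_cyclesBoundaries [HasColimits A₃] [CountableAB4 A₃]
    (hA₁ : ∀ X : A₁, ∃ (P : A₁) (π : P ⟶ X), S.flat₁ P ∧ Epi π) (C₁ : ChainComplex A₁ ℤ)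
    {C₂ : ChainComplex A₂ ℤ} (hB : ∀ q, S.flat₂ (shiftedBoundaries C₂ q)) :
    (S.tensorShortComplex C₁ (cyclesBoundaries C₂)).ShortExact := by
  refine S.shortExact_tensorShortComplex C₁ (shortExact_cyclesBoundaries C₂) fun p q => ?_
  obtain ⟨P, π, hP, _⟩ := hA₁ (C₁.X p)
  have hE : (ShortComplex.mk (kernel.ι π) π (kernel.condition π)).ShortExact :=
    { exact := ShortComplex.exact_kernel π }
  exact S.mono_map_of_flat₂ hE hP ((shortExact_cyclesBoundaries C₂).map_of_exact
    (HomologicalComplex.eval A₂ _ q)) (hB q)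

variable [HasColimits A₃] (C₁ : ChainComplex A₁ ℤ) {C₂ : ChainComplex A₂ ℤ}

section Tor

lemma exists_tor_one_exact [CountableAB4 A₃] {X₁ : A₁} {F : ShortComplex A₂}
    (hF : F.ShortExact) (hF₂ : S.flat₂ F.X₂) (R₁ : CompleteResolution S.flat₁ X₁)
    (R₂ : CompleteResolution S.flat₂ F.X₃) :
    ∃ (k : S.tor R₁ R₂ 1 ⟶ (S.T.obj X₁).obj F.X₁) (w : k ≫ (S.T.obj X₁).map F.f = 0),
      Mono k ∧ (ShortComplex.mk k _ w).Exact := by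
  obtain ⟨e⟩ := S.nonempty_tor_one_iso hF hF₂ R₁ R₂
  exact ⟨e.hom ≫ kernel.ι _, by simp, inferInstance, ShortComplex.exact_of_f_is_kernel _
    (IsLimit.ofIsoLimit (kernelIsKernel _) (Fork.ext e.symm (by simp)))⟩

/-- `isColimitHomologyι` in degree `m`, reindexed by the bidegrees of total degree `m + 1`. -/
def isColimitHomologyιCycles [CountableAB4 A₃] (hZ : ∀ q, S.flat₂ (C₂.cycles q)) (n m : ℤ)
    (hm : m + 1 = n) :
    IsColimit (Cofan.mk ((S.tensorZero C₁ fun q => C₂.cycles q).homology m)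
      fun x : Bidegree n =>
        S.homologyι C₁ (fun q => C₂.cycles q) x.1.1 (x.1.2 - 1) m (by lia)) :=
  let e : Bidegree n ≃ Bidegree m :=
    { toFun x := ⟨(x.1.1, x.1.2 - 1), by lia⟩
      invFun x := ⟨(x.1.1, x.1.2 + 1), by lia⟩
      left_inv x := by simp
      right_inv x := by simp }
  Cofan.isColimitEquivOfEquiv e _ (S.isColimitHomologyι C₁ hZ m)

variable {C₁} (hS : (S.tensorShortComplex C₁ (cyclesBoundaries C₂)).ShortExact)

lemma exists_tor_one_exact_δ [CountableAB4 A₃] (hB : ∀ q, S.flat₂ (shiftedBoundaries C₂ q))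
    (hZ : ∀ q, S.flat₂ (C₂.cycles q))
    (R₁ : ∀ p : ℤ, CompleteResolution S.flat₁ (C₁.homology p))
    (R₂ : ∀ q : ℤ, CompleteResolution S.flat₂ (C₂.homology q)) (n m : ℤ) (hm : m + 1 = n) :
    ∃ (κ : (S.torOneComplex C₁ C₂ R₁ R₂).X n ⟶
        (S.tensorZero C₁ (shiftedBoundaries C₂)).homology n) (w : κ ≫ S.δ hS n m hm = 0),
      Mono κ ∧ (ShortComplex.mk κ (S.δ hS n m hm) w).Exact := by
  have hk (x : Bidegree n) := S.exists_tor_one_exact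
    (shortExact_boundariesCyclesHomology C₂ x.1.2) (hZ (x.1.2 - 1)) (R₁ x.1.1) (R₂ (x.1.2 - 1))
  choose k wk hk_mono hk using hk
  let t (x : Bidegree n) :
      S.tor (R₁ x.1.1) (R₂ (x.1.2 - 1)) 1 ⟶ (S.torOneComplex C₁ C₂ R₁ R₂).X n :=
    Sigma.ι (fun x : Bidegree n => S.tor (R₁ x.1.1) (R₂ (x.1.2 - 1)) 1) x
  have hTor : IsColimit (Cofan.mk _ t) := coproductIsCoproduct _
  let j (x : Bidegree n) := S.homologyι C₁ (shiftedBoundaries C₂) x.1.1 x.1.2 n x.2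
  let κ : (S.torOneComplex C₁ C₂ R₁ R₂).X n ⟶
      (S.tensorZero C₁ (shiftedBoundaries C₂)).homology n := Sigma.desc fun x => k x ≫ j x
  have hκ (x : Bidegree n) : t x ≫ κ = k x ≫ j x := Sigma.ι_desc _ x
  have hδ (x : Bidegree n) := S.homologyι_δ hS x.1.1 x.1.2 n m x.2 hm
  have w : κ ≫ S.δ hS n m hm = 0 := by
    refine Cofan.IsColimit.hom_ext hTor _ _ fun x => ?_
    change t x ≫ κ ≫ _ = t x ≫ 0
    rw [reassoc_of% hκ x, hδ, Linear.units_smul_comp, Linear.comp_units_smul,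
      reassoc_of% wk x, zero_comp, smul_zero, comp_zero]
  have hBι := S.isColimitHomologyι C₁ hB n
  refine ⟨κ, w, mono_of_isColimit_cofan hk_mono hTor hBι κ hκ,
    exact_of_isColimit_cofan
      (fun x =>
        { τ₁ := t x
          τ₂ := j x
          τ₃ := S.homologyι C₁ (fun q => C₂.cycles q) x.1.1 (x.1.2 - 1) m (by lia)
          comm₁₂ := hκ x
          comm₂₃ := hδ x })
      (fun x => exact_units_smul_right (hk x) (Int.negOnePow x.1.1))
      hTor hBι (S.isColimitHomologyιCycles C₁ hZ n m hm)⟩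

end Tor

section Gamma

variable (C₂) in
/-- The inclusion of the summand `T(H_p(C₁), H_q(C₂))` of `T(H(C₁), H(C₂))`. -/
def tensorHomologyι (p q n : ℤ) (h : p + q = n) :
    (S.T.obj (C₁.homology p)).obj (C₂.homology q) ⟶
      (S.tensor (homologyComplex C₁) (homologyComplex C₂)).X n :=
  S.ι (homologyComplex C₁) (homologyComplex C₂) p q n h

lemma tensorHomologyι_γ (p q n : ℤ) (h : p + q = n) :
    S.tensorHomologyι C₁ C₂ p q n h ≫ (S.γ C₁ C₂).f n = S.γComponent C₁ C₂ p q n h :=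
  S.ι_γ C₁ C₂ p q n h

/-- The morphism `H_n(T(C₁, Z(C₂))) ⟶ T(H(C₁), H(C₂))_n` induced by `Z(C₂) ⟶ H(C₂)`. -/
def homologyTensorπ [CountableAB4 A₃] (hZ : ∀ q, S.flat₂ (C₂.cycles q)) (n : ℤ) :
    (S.tensorZero C₁ fun q => C₂.cycles q).homology n ⟶
      (S.tensor (homologyComplex C₁) (homologyComplex C₂)).X n :=
  Cofan.IsColimit.desc (S.isColimitHomologyι C₁ hZ n) fun x =>
    (S.T.obj (C₁.homology x.1.1)).map (C₂.homologyπ x.1.2) ≫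
      S.tensorHomologyι C₁ C₂ x.1.1 x.1.2 n x.2

lemma homologyι_homologyTensorπ [CountableAB4 A₃] (hZ : ∀ q, S.flat₂ (C₂.cycles q))
    (p q n : ℤ) (h : p + q = n) :
    S.homologyι C₁ (fun q => C₂.cycles q) p q n h ≫ S.homologyTensorπ C₁ hZ n =
      (S.T.obj (C₁.homology p)).map (C₂.homologyπ q) ≫
        S.tensorHomologyι C₁ C₂ p q n h :=
  Cofan.IsColimit.fac (S.isColimitHomologyι C₁ hZ n) _ ⟨(p, q), h⟩

lemma epi_homologyTensorπ [CountableAB4 A₃] (hZ : ∀ q, S.flat₂ (C₂.cycles q)) (n : ℤ) :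
    Epi (S.homologyTensorπ C₁ hZ n) where
  left_cancellation f g hfg := S.tensor_hom_ext fun p q h => by
    change S.tensorHomologyι C₁ C₂ p q n h ≫ f = S.tensorHomologyι C₁ C₂ p q n h ≫ g
    have hπ := S.homologyι_homologyTensorπ C₁ hZ p q n h
    rw [← cancel_epi ((S.T.obj (C₁.homology p)).map (C₂.homologyπ q)), ← reassoc_of% hπ, hfg,
      reassoc_of% hπ]

lemma homologyTensorπ_γ [CountableAB4 A₃] (hZ : ∀ q, S.flat₂ (C₂.cycles q)) (n : ℤ) :
    S.homologyTensorπ C₁ hZ n ≫ (S.γ C₁ C₂).f n =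
      HomologicalComplex.homologyMap (S.tensorMap C₁ (cyclesInclusion C₂)) n := by
  have h (x : Bidegree n) :
      S.homologyι C₁ _ x.1.1 x.1.2 n x.2 ≫ S.homologyTensorπ C₁ hZ n ≫ (S.γ C₁ C₂).f n =
        S.homologyι C₁ _ x.1.1 x.1.2 n x.2 ≫
          HomologicalComplex.homologyMap (S.tensorMap C₁ (cyclesInclusion C₂)) n := by
    rw [reassoc_of% S.homologyι_homologyTensorπ C₁ hZ x.1.1 x.1.2 n x.2, tensorHomologyι_γ]
    exact (S.homologyι_homologyMap C₁ C₂ x.1.1 x.1.2 n x.2).symm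
  exact Cofan.IsColimit.hom_ext (S.isColimitHomologyι C₁ hZ n) _ _ h

lemma δ_homologyTensorπ [CountableAB4 A₃]
    (hS : (S.tensorShortComplex C₁ (cyclesBoundaries C₂)).ShortExact)
    (hB : ∀ q, S.flat₂ (shiftedBoundaries C₂ q)) (hZ : ∀ q, S.flat₂ (C₂.cycles q)) (n m : ℤ)
    (hm : m + 1 = n) : S.δ hS n m hm ≫ S.homologyTensorπ C₁ hZ m = 0 := by
  refine Cofan.IsColimit.hom_ext (S.isColimitHomologyι C₁ hB n) _ _ fun x => ?_
  change S.homologyι C₁ _ x.1.1 x.1.2 n x.2 ≫ _ = S.homologyι C₁ _ x.1.1 x.1.2 n x.2 ≫ 0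
  rw [reassoc_of% S.homologyι_δ hS x.1.1 x.1.2 n m x.2 hm, homologyι_homologyTensorπ, comp_zero,
    Linear.units_smul_comp, ← Functor.map_comp_assoc, boundariesToCycles_homologyπ,
    CategoryTheory.Functor.map_zero, zero_comp, smul_zero]

end Gamma

lemma exists_shortExact_γ_f [CountableAB4 A₃]
    (hA₁ : ∀ X : A₁, ∃ (P : A₁) (π : P ⟶ X), S.flat₁ P ∧ Epi π)
    (hB : ∀ q, S.flat₂ (shiftedBoundaries C₂ q)) (hZ : ∀ q, S.flat₂ (C₂.cycles q))
    (R₁ : ∀ p : ℤ, CompleteResolution S.flat₁ (C₁.homology p))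
    (R₂ : ∀ q : ℤ, CompleteResolution S.flat₂ (C₂.homology q)) (n : ℤ) :
    ∃ (β : (S.tensor C₁ C₂).homology n ⟶ (S.torOneComplex C₁ C₂ R₁ R₂).X n)
      (w : (S.γ C₁ C₂).f n ≫ β = 0), (ShortComplex.mk _ β w).ShortExact := by
  have hS := S.shortExact_tensor_cyclesBoundaries hA₁ C₁ hB
  obtain ⟨κ, wκ, hκ_mono, hκ⟩ := S.exists_tor_one_exact_δ hS hB hZ R₁ R₂ n (n - 1) (by lia)
  exact exists_shortExact_of_exact (hS.homology_exact₁ (n + 1) n rfl) (hS.homology_exact₂ n)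
    (hS.homology_exact₃ n (n - 1) (by simp)) (S.δ_homologyTensorπ C₁ hS hB hZ (n + 1) n rfl)
    (S.epi_homologyTensorπ C₁ hZ n) (S.homologyTensorπ_γ C₁ hZ n) hκ hκ_mono

theorem exists_shortExact_γ [CountableAB4 A₃]
    (hA₁ : ∀ X : A₁, ∃ (P : A₁) (π : P ⟶ X), S.flat₁ P ∧ Epi π)
    (hB : ∀ n, S.flat₂ (boundaries C₂ n)) (hZ : ∀ n, S.flat₂ (C₂.cycles n))
    (R₁ : ∀ p : ℤ, CompleteResolution S.flat₁ (C₁.homology p))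
    (R₂ : ∀ q : ℤ, CompleteResolution S.flat₂ (C₂.homology q)) :
    ∃ (δ : homologyComplex (S.tensor C₁ C₂) ⟶ S.torOneComplex C₁ C₂ R₁ R₂)
      (w : S.γ C₁ C₂ ≫ δ = 0), (ShortComplex.mk (S.γ C₁ C₂) δ w).ShortExact := by
  choose β w hβ using S.exists_shortExact_γ_f C₁ hA₁ (S.flat₂_shiftedBoundaries hB) hZ R₁ R₂
  let δ : homologyComplex (S.tensor C₁ C₂) ⟶ S.torOneComplex C₁ C₂ R₁ R₂ :=
    { f := β
      comm' := fun _ _ _ => comp_zero.trans zero_comp.symm }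
  exact ⟨δ, HomologicalComplex.hom_ext _ _ w,
    HomologicalComplex.shortExact_of_degreewise_shortExact _ hβ⟩

end Kunneth

end BiadditiveTHC

end THCKunneth
end

theorem mainTheorem3_general {A₁ : Type u₁} {A₂ : Type u₂} {A₃ : Type u₃}
    [Category.{v₁} A₁] [Category.{v₂} A₂] [Category.{v₃} A₃]
    [Abelian A₁] [Abelian A₂] [Abelian A₃] [HasColimits A₃] [CountableAB4 A₃]
    (S : THCKunneth.BiadditiveTHC A₁ A₂ A₃)
    (h₁ : THCKunneth.IsLeftCompleteCotorsionTheory S.flat₁ (THCKunneth.rightPerp S.flat₁))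
    (h₂ : THCKunneth.IsLeftCompleteCotorsionTheory S.flat₂ (THCKunneth.rightPerp S.flat₂))
    (C₁ : ChainComplex A₁ ℤ) (C₂ : ChainComplex A₂ ℤ)
    (hB : ∀ n : ℤ, S.flat₂ (THCKunneth.boundaries C₂ n))
    (hZ : ∀ n : ℤ, S.flat₂ (C₂.cycles n)) :
    (∀ X : A₁, Nonempty (THCKunneth.CompleteResolution S.flat₁ X)) ∧
    (∀ X : A₂, Nonempty (THCKunneth.CompleteResolution S.flat₂ X)) ∧
    ∀ (R₁ : ∀ p : ℤ, THCKunneth.CompleteResolution S.flat₁ (C₁.homology p))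
      (R₂ : ∀ q : ℤ, THCKunneth.CompleteResolution S.flat₂ (C₂.homology q)),
      ∃ (δ : THCKunneth.homologyComplex (S.tensor C₁ C₂) ⟶ S.torOneComplex C₁ C₂ R₁ R₂)
        (w : S.γ C₁ C₂ ≫ δ = 0), (ShortComplex.mk (S.γ C₁ C₂) δ w).ShortExact := by
  refine ⟨fun X => h₁.nonempty_completeResolution X, fun X => h₂.nonempty_completeResolution X,
    fun R₁ R₂ => S.exists_shortExact_γ C₁ (fun X => ?_) hB hZ R₁ R₂⟩
  obtain ⟨_, P, _, π, _, _, hP, hE⟩ := h₁.exists_shortExact X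
  exact ⟨P, π, hP, hE.epi_g⟩

theorem mainTheorem3 {A₁ : Type u₁} {A₂ : Type u₂} {A₃ : Type u₃}
    [Category.{v₁} A₁] [Category.{v₂} A₂] [Category.{v₃} A₃]
    [Abelian A₁] [Abelian A₂] [Abelian A₃] [HasColimits A₃] [AB5 A₃]
    (S : THCKunneth.BiadditiveTHC A₁ A₂ A₃)
    (h₁ : THCKunneth.IsLeftCompleteCotorsionTheory S.flat₁ (THCKunneth.rightPerp S.flat₁))
    (h₂ : THCKunneth.IsLeftCompleteCotorsionTheory S.flat₂ (THCKunneth.rightPerp S.flat₂))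
    (C₁ : ChainComplex A₁ ℤ) (C₂ : ChainComplex A₂ ℤ)
    (hB : ∀ n : ℤ, S.flat₂ (THCKunneth.boundaries C₂ n))
    (hZ : ∀ n : ℤ, S.flat₂ (C₂.cycles n)) :
    (∀ X : A₁, Nonempty (THCKunneth.CompleteResolution S.flat₁ X)) ∧
    (∀ X : A₂, Nonempty (THCKunneth.CompleteResolution S.flat₂ X)) ∧
    ∀ (R₁ : ∀ p : ℤ, THCKunneth.CompleteResolution S.flat₁ (C₁.homology p))
      (R₂ : ∀ q : ℤ, THCKunneth.CompleteResolution S.flat₂ (C₂.homology q)),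
      ∃ (δ : THCKunneth.homologyComplex (S.tensor C₁ C₂) ⟶ S.torOneComplex C₁ C₂ R₁ R₂)
        (w : S.γ C₁ C₂ ≫ δ = 0), (ShortComplex.mk (S.γ C₁ C₂) δ w).ShortExact :=
  have := Abelian.hasFiniteBiproducts (C := A₃)
  have := AB4.of_AB5 A₃
  mainTheorem3_general S h₁ h₂ C₁ C₂ hB hZ
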